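/- Let $\mathbb K$ be $\mathbb R$ or $\mathbb C$, and let $B_E$, $S_E$, $E^*$ denote the closed unit ball, the unit sphere and the dual of a Banach space $E$ over $\mathbb K$. A slice of $B_E$ is a set $S(x^*,\varepsilon)=\{y\in B_E:\operatorname{Re}x^*(y)>1-\varepsilon\}$ with $x^*\in S_{E^*}$, $\varepsilon>0$. A convex combination of slices is a set $\sum_{i=1}^m\lambda_iS_i$ with $m\ge 1$, slices $S_i$ of $B_E$, $\lambda_i>0$ and $\sum_i\lambda_i=1$. For $x\in S_E$ and a set $C\subset B_E$ write $(\ast)_C$ for $\sup_{y\in C}\|x-y\|=2$. The point $x\in S_E$ is called * *ccs-Daugavet* (*ccs-$\Delta$*) if $(\ast)_C$ holds for every convex combination of slices $C$ of $B_E$ (that contains $x$); * *super-Daugavet* (*super-$\Delta$*) if $(\ast)_W$ holds for every nonempty relatively weakly open $W\subset B_E$ (that contains $x$); * *Daugavet* (*$\Delta$*) if $(\ast)_S$ holds for every slice $S$ of $B_E$ (that contains $x$); * *$\nabla$* if $(\ast)_S$ holds for every slice $S$ of $B_E$ that does not contain $x$; * *$\Delta_p$*, where $p>1$, if for all $x^*\in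 S_{E^*}$ and $\alpha>0$ with $x\in S(x^*,\alpha)$ and all $\varepsilon>0$ there is $u\in S(x^*,p\alpha)$ with $\|x-u\|\ge 2-\varepsilon$. **Theorem.** Let $L$ be a locally compact Hausdorff space, let $X$ be a Banach space over $\mathbb K$, let $C_0(L,X)$ be the space of continuous functions $L\to X$ vanishing at infinity with the supremum norm, and let $f\in S_{C_0(L,X)}$. 1. If there is a non-isolated point $t_0$ of $L$ with $\|f(t_0)\|=\|f\|_\infty$, then $f$ is a ccs-Daugavet point. 2. Otherwise, the set $T$ of isolated points $t$ of $L$ with $\|f(t)\|=\|f\|_\infty$ is finite and non-empty. Write $T=\{t_1,\dots,t_n\}$ with distinct $t_k$; then $g\mapsto(g(t_1),\dots,g(t_n))$ is an isometric isomorphism of $C_0(T,X)$ onto $X\oplus_\infty\overset{n)}{\cdots}\oplus_\infty X$, and the following hold. - (a) $f$ is super-Daugavet (resp. super-$\Delta$, ccs-Daugavet) if and only if $f|_T$ is super-Daugavet (resp. super-$\Delta$, ccs-Daugavet) in $C_0(T,X)$. - (b) $f$ is Daugavet if and only if $f(t_k)$ is Daugavet in $X$ for some $k$. - (c) If $f$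 is ccs-$\Delta$, then $f|_T$ is ccs-$\Delta$ in $C_0(T,X)$. - (d) $f$ is $\Delta$ if and only if either $f(t_k)$ is $\Delta$ in $X$ for some $k$, or $n\ge 2$ and for all $p_1,\dots,p_n\in(1,\infty)$ with $\sum_{k=1}^n\frac1{p_k}=1$ there is some $k$ such that $f(t_k)$ is $\Delta_{p_k}$ in $X$. - (e) If $L\ne T$, or if $\mathbb K=\mathbb C$, then $f$ is $\nabla$ if and only if $f$ is Daugavet. - (f) If $L=T$, then $f$ is $\nabla$ if and only if either $f(t_k)$ is $\nabla$ in $X$ for all $k$, or $f(t_k)$ is Daugavet in $X$ for some $k$ (and in the latter case $f$ is Daugavet as well). -/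

import Mathlib

open scoped ZeroAtInfty

/-- The slice `S(A, x*, ε)` of the (bounded) set `A`. -/
def slice (𝕜 : Type*) [RCLike 𝕜] {E : Type*} [NormedAddCommGroup E] [NormedSpace 𝕜 E]
    (A : Set E) (φ : StrongDual 𝕜 E) (ε : ℝ) : Set E :=
  {x | x ∈ A ∧ sSup ((fun y => RCLike.re (φ y)) '' A) - ε < RCLike.re (φ x)}

/-- `S` is a slice of `A`: it is cut by a norm-one functional and a positive number. -/
def IsSlice (𝕜 : Type*) [RCLike 𝕜] {E : Type*} [NormedAddCommGroup E] [NormedSpace 𝕜 E]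
    (A S : Set E) : Prop :=
  ∃ (φ : StrongDual 𝕜 E) (ε : ℝ), ‖φ‖ = 1 ∧ 0 < ε ∧ S = slice 𝕜 A φ ε

/-- `C` is a convex combination of slices of `A`. -/
def IsConvexCombOfSlices (𝕜 : Type*) [RCLike 𝕜] {E : Type*} [NormedAddCommGroup E]
    [NormedSpace 𝕜 E] (A C : Set E) : Prop :=
  ∃ (n : ℕ) (c : Fin n → ℝ) (S : Fin n → Set E),
    (∀ i, 0 < c i) ∧ ∑ i, c i = 1 ∧ (∀ i, IsSlice 𝕜 A (S i)) ∧
    C = {x | x ∈ A ∧ ∃ y : Fin n → E, (∀ i, y i ∈ S i) ∧ x = ∑ i, ((c i : ℝ) : 𝕜) • y i}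

/-- `W` is a relatively weakly open subset of `A`. -/
def IsRelWeaklyOpen (𝕜 : Type*) [RCLike 𝕜] {E : Type*} [NormedAddCommGroup E]
    [NormedSpace 𝕜 E] (A W : Set E) : Prop :=
  ∃ U : Set (WeakSpace 𝕜 E), IsOpen U ∧ W = {x | x ∈ A ∧ toWeakSpace 𝕜 E x ∈ U}

/-- The supremum of `‖x - y‖` over `y ∈ S` is `2`. -/
def SupDistEqTwo {E : Type*} [NormedAddCommGroup E] (x : E) (S : Set E) : Prop :=
  IsLUB ((fun y => ‖x - y‖) '' S) 2

/-- ccs-Daugavet points. -/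
def IsCcsDaugavetPoint (𝕜 : Type*) [RCLike 𝕜] {E : Type*} [NormedAddCommGroup E]
    [NormedSpace 𝕜 E] (x : E) : Prop :=
  ‖x‖ = 1 ∧ ∀ C : Set E, IsConvexCombOfSlices 𝕜 (Metric.closedBall 0 1) C → SupDistEqTwo x C

/-- super-Daugavet points. -/
def IsSuperDaugavetPoint (𝕜 : Type*) [RCLike 𝕜] {E : Type*} [NormedAddCommGroup E]
    [NormedSpace 𝕜 E] (x : E) : Prop :=
  ‖x‖ = 1 ∧ ∀ W : Set E, IsRelWeaklyOpen 𝕜 (Metric.closedBall 0 1) W → W.Nonempty →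
    SupDistEqTwo x W

/-- Daugavet points. -/
def IsDaugavetPoint (𝕜 : Type*) [RCLike 𝕜] {E : Type*} [NormedAddCommGroup E]
    [NormedSpace 𝕜 E] (x : E) : Prop :=
  ‖x‖ = 1 ∧ ∀ S : Set E, IsSlice 𝕜 (Metric.closedBall 0 1) S → SupDistEqTwo x S

/-- ccs-Δ points. -/
def IsCcsDeltaPoint (𝕜 : Type*) [RCLike 𝕜] {E : Type*} [NormedAddCommGroup E]
    [NormedSpace 𝕜 E] (x : E) : Prop :=
  ‖x‖ = 1 ∧ ∀ C : Set E, IsConvexCombOfSlices 𝕜 (Metric.closedBall 0 1) C → x ∈ C →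
    SupDistEqTwo x C

/-- super-Δ points. -/
def IsSuperDeltaPoint (𝕜 : Type*) [RCLike 𝕜] {E : Type*} [NormedAddCommGroup E]
    [NormedSpace 𝕜 E] (x : E) : Prop :=
  ‖x‖ = 1 ∧ ∀ W : Set E, IsRelWeaklyOpen 𝕜 (Metric.closedBall 0 1) W → x ∈ W →
    SupDistEqTwo x W

/-- Δ points. -/
def IsDeltaPoint (𝕜 : Type*) [RCLike 𝕜] {E : Type*} [NormedAddCommGroup E]
    [NormedSpace 𝕜 E] (x : E) : Prop :=
  ‖x‖ = 1 ∧ ∀ S : Set E, IsSlice 𝕜 (Metric.closedBall 0 1) S → x ∈ S → SupDistEqTwo x S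

/-- ∇ points. -/
def IsNablaPoint (𝕜 : Type*) [RCLike 𝕜] {E : Type*} [NormedAddCommGroup E]
    [NormedSpace 𝕜 E] (x : E) : Prop :=
  ‖x‖ = 1 ∧ ∀ S : Set E, IsSlice 𝕜 (Metric.closedBall 0 1) S → x ∉ S → SupDistEqTwo x S

/-- Δ_p points (used for `p > 1`). -/
def IsDeltaPPoint (𝕜 : Type*) [RCLike 𝕜] {E : Type*} [NormedAddCommGroup E]
    [NormedSpace 𝕜 E] (p : ℝ) (x : E) : Prop :=
  ‖x‖ = 1 ∧ ∀ (φ : StrongDual 𝕜 E) (α : ℝ), ‖φ‖ = 1 → 0 < α →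
    x ∈ slice 𝕜 (Metric.closedBall 0 1) φ α →
    ∀ ε : ℝ, 0 < ε → ∃ u ∈ slice 𝕜 (Metric.closedBall 0 1) φ (p * α), 2 - ε ≤ ‖x - u‖

/-- The restriction of a function in `C₀(L, X)` to a closed subset `T` of `L`. -/
def restrictC0 {L X : Type*} [TopologicalSpace L] [NormedAddCommGroup X]
    (f : C₀(L, X)) (T : Set L) (hT : IsClosed T) : C₀(T, X) :=
  f.comp
    { toFun := Subtype.val
      continuous_toFun := continuous_subtype_val
      cocompact_tendsto' := hT.isClosedEmbedding_subtypeVal.tendsto_cocompact }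

/-- The isolated points of `L` (those that are not limit points of `L`) at which `f` attains
its norm. -/
def isolatedNormAttaining {L X : Type*} [TopologicalSpace L] [NormedAddCommGroup X]
    (f : C₀(L, X)) : Set L :=
  {t | t ∉ derivedSet (Set.univ : Set L) ∧ ‖f t‖ = ‖f‖}

/-! Near a non-isolated norm-attaining point there are infinitely many `s` with `‖f s‖` almost 1.
Finitely many of them carry disjointly supported bumps `u`. Replacing chosen elements `g i` of the
slices by `(1 - u) g i - u f` changes the values of the functionals by amounts whose sum over all
bumps is bounded (`sum_norm_apply_bumpSMul_le`). With enough bumps, one of them changes every value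
negligibly, while each new element equals `-f s` at `s`, and so does their convex combination.

Otherwise the norm-attaining set `T` is finite and clopen, and `f` has norm at most `1 - η` off it,
so a ball element almost at distance 2 from `f` is already that far on `T`. As `C₀(T, X)` is an
`ℓ_∞`-summand (`IsMSummand`), slices and weakly open sets are transferred by changing elements on
`T` only.

What remains is a finite `ℓ_∞`-sum. Given one slice `S(φ k, β k)` without far points per coordinate,
the functional `∑ φ k / β k` cuts out a half ball whose elements have every coordinate in the
corresponding slice (`not_hasFarPoints_pi`). The necessity halves of the Daugavet, Δ and ∇ criteria
differ only in how these slices are chosen. A ∇ point is forced to be Daugavet by adding a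
functional living off `T`, or, over the complex field, by rotating the functional. -/

/-- The set `S` contains points at distance from `x` arbitrarily close to `2`. -/
def HasFarPoints {E : Type*} [NormedAddCommGroup E] (x : E) (S : Set E) : Prop :=
  ∀ ε : ℝ, 0 < ε → ∃ u ∈ S, 2 - ε ≤ ‖x - u‖

/-- The part of the closed unit ball where `re ∘ φ` exceeds `c`. -/
def halfBall {𝕜 : Type*} [RCLike 𝕜] {E : Type*} [NormedAddCommGroup E] [NormedSpace 𝕜 E]
    (φ : StrongDual 𝕜 E) (c : ℝ) : Set E :=
  {u | ‖u‖ ≤ 1 ∧ c < RCLike.re (φ u)}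

/-! ### Slices as half balls of arbitrary functionals -/

section HalfBall

variable {𝕜 : Type*} [RCLike 𝕜] {E : Type*} [NormedAddCommGroup E] [NormedSpace 𝕜 E]

theorem HasFarPoints.mono {x : E} {S S' : Set E} (h : HasFarPoints x S) (hS : S ⊆ S') :
    HasFarPoints x S' := fun ε hε =>
  let ⟨u, hu, hd⟩ := h ε hε
  ⟨u, hS hu, hd⟩

theorem not_hasFarPoints {x : E} {S : Set E} :
    ¬ HasFarPoints x S ↔ ∃ ε : ℝ, 0 < ε ∧ ∀ u ∈ S, ‖x - u‖ < 2 - ε := by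
  simp only [HasFarPoints, not_forall, not_exists, not_and, not_le, exists_prop]

/-- The triangle inequality already bounds distances by 2 here, so only the existence of far points
carries information. -/
theorem supDistEqTwo_iff {x : E} (hx : ‖x‖ = 1) {S : Set E} (hS : ∀ u ∈ S, ‖u‖ ≤ 1) :
    SupDistEqTwo x S ↔ HasFarPoints x S := by
  constructor
  · intro h ε hε
    obtain ⟨_, ⟨u, hu, rfl⟩, hlt, -⟩ := h.exists_between (sub_lt_self 2 hε)
    exact ⟨u, hu, hlt.le⟩
  · intro h
    refine ⟨?_, fun b hb => le_of_forall_pos_le_add fun ε hε => ?_⟩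
    · rintro _ ⟨u, hu, rfl⟩
      have := norm_sub_le x u
      have := hS u hu
      simp only
      linarith
    · obtain ⟨u, hu, hd⟩ := h ε hε
      have := hb ⟨u, hu, rfl⟩
      simp only at this
      linarith

theorem re_apply_le_norm (φ : StrongDual 𝕜 E) {u : E} (hu : ‖u‖ ≤ 1) :
    RCLike.re (φ u) ≤ ‖φ‖ :=
  (RCLike.re_le_norm _).trans <| (φ.le_opNorm u).trans <|
    mul_le_of_le_one_right (norm_nonneg _) hu

theorem exists_lt_re_apply (φ : StrongDual 𝕜 E) {r : ℝ} (hr : r < ‖φ‖) :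
    (halfBall φ r).Nonempty := by
  obtain ⟨u, hu, hru⟩ := φ.exists_lt_apply_of_lt_opNorm hr
  obtain ⟨c, hc, hcu⟩ := RCLike.exists_norm_eq_mul_self (φ u)
  refine ⟨c • u, by simpa [norm_smul, hc] using hu.le, ?_⟩
  rw [map_smul, smul_eq_mul, ← hcu, RCLike.ofReal_re]
  exact hru

theorem sSup_re_image_closedBall (φ : StrongDual 𝕜 E) :
    sSup ((fun y => RCLike.re (φ y)) '' Metric.closedBall 0 1) = ‖φ‖ := by
  refine csSup_eq_of_forall_le_of_forall_lt_exists_gt ⟨_, 0, by simp, rfl⟩ ?_ ?_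
  · rintro _ ⟨u, hu, rfl⟩
    exact re_apply_le_norm φ (by simpa using hu)
  · intro r hr
    obtain ⟨u, hu, hru⟩ := exists_lt_re_apply φ hr
    exact ⟨_, ⟨u, by simpa using hu, rfl⟩, hru⟩

theorem slice_eq_halfBall (φ : StrongDual 𝕜 E) (ε : ℝ) :
    slice 𝕜 (Metric.closedBall 0 1) φ ε = halfBall φ (‖φ‖ - ε) := by
  ext u
  simp [slice, halfBall, sSup_re_image_closedBall]

theorem isSlice_iff {S : Set E} : IsSlice 𝕜 (Metric.closedBall 0 1) S ↔
    ∃ (φ : StrongDual 𝕜 E) (ε : ℝ), ‖φ‖ = 1 ∧ 0 < ε ∧ S = halfBall φ (1 - ε) := by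
  refine exists_congr fun φ => exists_congr fun ε => and_congr_right fun h => ?_
  rw [slice_eq_halfBall, h]

theorem norm_le_of_mem_slice {S : Set E} (hS : IsSlice 𝕜 (Metric.closedBall 0 1) S) {u : E}
    (hu : u ∈ S) : ‖u‖ ≤ 1 := by
  obtain ⟨φ, ε, -, -, rfl⟩ := isSlice_iff.1 hS
  exact hu.1

theorem halfBall_inv_norm_smul {φ : StrongDual 𝕜 E} (hφ : φ ≠ 0) (c : ℝ) :
    halfBall (((‖φ‖⁻¹ : ℝ) : 𝕜) • φ) (‖φ‖⁻¹ * c) = halfBall φ c := by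
  have h : 0 < ‖φ‖⁻¹ := inv_pos.2 (norm_pos_iff.2 hφ)
  ext u
  simp only [halfBall, Set.mem_ofPred_eq, smul_apply, smul_eq_mul,
    RCLike.re_ofReal_mul, mul_lt_mul_iff_right₀ h]

theorem norm_inv_norm_smul {φ : StrongDual 𝕜 E} (hφ : φ ≠ 0) :
    ‖((‖φ‖⁻¹ : ℝ) : 𝕜) • φ‖ = 1 := by
  have h : ‖φ‖ ≠ 0 := norm_ne_zero_iff.2 hφ
  rw [norm_smul, RCLike.norm_ofReal, abs_of_nonneg (by positivity), inv_mul_cancel₀ h]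

theorem isSlice_halfBall {φ : StrongDual 𝕜 E} (hφ : φ ≠ 0) {c : ℝ}
    (h : (halfBall φ c).Nonempty) : IsSlice 𝕜 (Metric.closedBall 0 1) (halfBall φ c) := by
  have h0 : 0 < ‖φ‖ := norm_pos_iff.2 hφ
  obtain ⟨u, hu, hcu⟩ := h
  have hc : c < ‖φ‖ := hcu.trans_le (re_apply_le_norm φ hu)
  refine isSlice_iff.2 ⟨((‖φ‖⁻¹ : ℝ) : 𝕜) • φ, 1 - ‖φ‖⁻¹ * c, norm_inv_norm_smul hφ, ?_, ?_⟩
  · rw [sub_pos, inv_mul_lt_iff₀ h0]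
    linarith
  · rw [sub_sub_cancel, halfBall_inv_norm_smul hφ]

/-- For the zero functional a nonempty half ball is the whole ball, and any slice will do; `x`
serves only to supply a norm-one functional. -/
theorem exists_isSlice_subset_halfBall {x : E} (hx : x ≠ 0) {φ : StrongDual 𝕜 E} {c : ℝ}
    (h : (halfBall φ c).Nonempty) :
    ∃ S ⊆ halfBall φ c, IsSlice 𝕜 (Metric.closedBall 0 1) S := by
  by_cases hφ : φ = 0
  · obtain ⟨χ, hχ, -⟩ := exists_dual_vector 𝕜 x (norm_ne_zero_iff.2 hx)
    refine ⟨halfBall χ (1 - 1), fun u hu => ⟨hu.1, ?_⟩, isSlice_iff.2 ⟨χ, 1, hχ, one_pos, rfl⟩⟩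
    obtain ⟨v, -, hv⟩ := h
    simpa [hφ] using hv
  · exact ⟨_, subset_rfl, isSlice_halfBall hφ h⟩

theorem hasFarPoints_halfBall_zero {x : E} (hx : ‖x‖ = 1) {c : ℝ}
    (h : (halfBall (0 : StrongDual 𝕜 E) c).Nonempty) :
    HasFarPoints x (halfBall (0 : StrongDual 𝕜 E) c) := by
  obtain ⟨v, -, hv⟩ := h
  refine fun ε hε => ⟨-x, ⟨by simp [hx], by simpa using hv⟩, ?_⟩
  have : ‖x - -x‖ = 2 := by
    rw [sub_neg_eq_add, ← two_smul 𝕜 x, norm_smul, hx]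
    simp
  linarith

/-- Dropping the normalisation matters because functionals composed with an embedding of a summand
can have any norm, including zero. -/
theorem isDaugavetPoint_iff {x : E} : IsDaugavetPoint 𝕜 x ↔ ‖x‖ = 1 ∧
    ∀ (φ : StrongDual 𝕜 E) (c : ℝ), (halfBall φ c).Nonempty → HasFarPoints x (halfBall φ c) := by
  refine and_congr_right fun hx => ⟨fun h φ c hne => ?_, fun h S hS => ?_⟩
  · by_cases hφ : φ = 0
    · subst hφ
      exact hasFarPoints_halfBall_zero hx hne
    · have hS := isSlice_halfBall hφ hne
      exact (supDistEqTwo_iff hx fun u => norm_le_of_mem_slice hS).1 (h _ hS)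
  · refine (supDistEqTwo_iff hx fun u => norm_le_of_mem_slice hS).2 ?_
    obtain ⟨φ, ε, hφ, hε, rfl⟩ := isSlice_iff.1 hS
    exact h _ _ (exists_lt_re_apply φ (by linarith))

theorem isDeltaPoint_iff {x : E} : IsDeltaPoint 𝕜 x ↔ ‖x‖ = 1 ∧
    ∀ (φ : StrongDual 𝕜 E) (c : ℝ), x ∈ halfBall φ c → HasFarPoints x (halfBall φ c) := by
  refine and_congr_right fun hx => ⟨fun h φ c hne => ?_, fun h S hS hxS => ?_⟩
  · by_cases hφ : φ = 0
    · subst hφ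
      exact hasFarPoints_halfBall_zero hx ⟨x, hne⟩
    · have hS := isSlice_halfBall hφ ⟨x, hne⟩
      exact (supDistEqTwo_iff hx fun u => norm_le_of_mem_slice hS).1 (h _ hS hne)
  · refine (supDistEqTwo_iff hx fun u => norm_le_of_mem_slice hS).2 ?_
    obtain ⟨φ, ε, hφ, hε, rfl⟩ := isSlice_iff.1 hS
    exact h _ _ hxS

theorem isNablaPoint_iff {x : E} : IsNablaPoint 𝕜 x ↔ ‖x‖ = 1 ∧
    ∀ (φ : StrongDual 𝕜 E) (c : ℝ), RCLike.re (φ x) ≤ c → (halfBall φ c).Nonempty →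
      HasFarPoints x (halfBall φ c) := by
  refine and_congr_right fun hx => ⟨fun h φ c hxc hne => ?_, fun h S hS hxS => ?_⟩
  · by_cases hφ : φ = 0
    · subst hφ
      exact hasFarPoints_halfBall_zero hx hne
    · have hS := isSlice_halfBall hφ hne
      exact (supDistEqTwo_iff hx fun u => norm_le_of_mem_slice hS).1
        (h _ hS fun hmem => hxc.not_gt hmem.2)
  · refine (supDistEqTwo_iff hx fun u => norm_le_of_mem_slice hS).2 ?_
    obtain ⟨φ, ε, hφ, hε, rfl⟩ := isSlice_iff.1 hS
    refine h _ _ ?_ (exists_lt_re_apply φ (by linarith))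
    by_contra! hlt
    exact hxS ⟨hx.le, hlt⟩

theorem IsDaugavetPoint.isNablaPoint {x : E} (h : IsDaugavetPoint 𝕜 x) : IsNablaPoint 𝕜 x :=
  ⟨h.1, fun S hS _ => h.2 S hS⟩

theorem isDeltaPPoint_iff {x : E} {p : ℝ} : IsDeltaPPoint 𝕜 p x ↔ ‖x‖ = 1 ∧
    ∀ (φ : StrongDual 𝕜 E) (α : ℝ), ‖φ‖ = 1 → 0 < α → x ∈ halfBall φ (1 - α) →
      HasFarPoints x (halfBall φ (1 - p * α)) := by
  refine and_congr_right fun hx => forall₃_congr fun φ α hφ => ?_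
  simp only [slice_eq_halfBall, hφ, HasFarPoints]

/-- Both widths scale with the norm of the functional, so normalising preserves their ratio `p`. -/
theorem IsDeltaPPoint.hasFarPoints {x : E} {p : ℝ} (h : IsDeltaPPoint 𝕜 p x)
    {φ : StrongDual 𝕜 E} {α : ℝ} (hα : 0 < α) (hx : x ∈ halfBall φ (‖φ‖ - α)) (hp : 0 < p) :
    HasFarPoints x (halfBall φ (‖φ‖ - p * α)) := by
  have hp' : 0 < p * α := mul_pos hp hα
  by_cases hφ : φ = 0
  · subst hφ
    refine hasFarPoints_halfBall_zero h.1 ⟨0, by simp, ?_⟩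
    simpa using hp'
  · have h0 : 0 < ‖φ‖ := norm_pos_iff.2 hφ
    have key : ∀ β : ℝ, ‖φ‖⁻¹ * (‖φ‖ - β) = 1 - β / ‖φ‖ := fun β => by
      field_simp
    have := (isDeltaPPoint_iff.1 h).2 _ (α / ‖φ‖) (norm_inv_norm_smul hφ) (by positivity)
      (by rwa [← key, halfBall_inv_norm_smul hφ])
    rwa [← mul_div_assoc, ← key, halfBall_inv_norm_smul hφ] at this

end HalfBall

/-! ### Convex combinations of half balls -/

section ConvexCombination

variable {𝕜 : Type*} [RCLike 𝕜] {E : Type*} [NormedAddCommGroup E] [NormedSpace 𝕜 E]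

/-- The combination `∑ i, c i • S i` of sets. -/
def combination (𝕜 : Type*) [RCLike 𝕜] {E : Type*} [NormedAddCommGroup E] [NormedSpace 𝕜 E]
    {n : ℕ} (c : Fin n → ℝ) (S : Fin n → Set E) : Set E :=
  {x | ∃ y : Fin n → E, (∀ i, y i ∈ S i) ∧ x = ∑ i, ((c i : ℝ) : 𝕜) • y i}

theorem norm_sum_smul_le_one {n : ℕ} {c : Fin n → ℝ} (hc : ∀ i, 0 < c i) (hc1 : ∑ i, c i = 1)
    {y : Fin n → E} (hy : ∀ i, ‖y i‖ ≤ 1) : ‖∑ i, ((c i : ℝ) : 𝕜) • y i‖ ≤ 1 := by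
  refine (norm_sum_le _ _).trans ((Finset.sum_le_sum fun i _ => ?_).trans hc1.le)
  rw [norm_smul, RCLike.norm_ofReal, abs_of_pos (hc i)]
  exact mul_le_of_le_one_right (hc i).le (hy i)

theorem isConvexCombOfSlices_iff {C : Set E} :
    IsConvexCombOfSlices 𝕜 (Metric.closedBall 0 1) C ↔
    ∃ (n : ℕ) (c : Fin n → ℝ) (S : Fin n → Set E), (∀ i, 0 < c i) ∧ ∑ i, c i = 1 ∧
      (∀ i, IsSlice 𝕜 (Metric.closedBall 0 1) (S i)) ∧ C = combination 𝕜 c S := by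
  refine exists_congr fun n => exists_congr fun c => exists_congr fun S =>
    and_congr_right fun hc => and_congr_right fun hc1 => and_congr_right fun hS => ?_
  suffices {x | x ∈ Metric.closedBall (0 : E) 1 ∧ ∃ y : Fin n → E, (∀ i, y i ∈ S i) ∧
      x = ∑ i, ((c i : ℝ) : 𝕜) • y i} = combination 𝕜 c S by rw [this]
  ext x
  refine and_iff_right_of_imp ?_
  rintro ⟨y, hy, rfl⟩
  simpa using norm_sum_smul_le_one hc hc1 fun i => norm_le_of_mem_slice (hS i) (hy i)

theorem IsConvexCombOfSlices.norm_le {C : Set E}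
    (hC : IsConvexCombOfSlices 𝕜 (Metric.closedBall 0 1) C) {u : E} (hu : u ∈ C) : ‖u‖ ≤ 1 := by
  obtain ⟨n, c, S, -, -, -, rfl⟩ := hC
  simpa using hu.1

theorem combination_mono {n : ℕ} (c : Fin n → ℝ) {S S' : Fin n → Set E} (h : ∀ i, S i ⊆ S' i) :
    combination 𝕜 c S ⊆ combination 𝕜 c S' := by
  rintro _ ⟨y, hy, rfl⟩
  exact ⟨y, fun i => h i (hy i), rfl⟩

theorem isCcsDaugavetPoint_iff {x : E} : IsCcsDaugavetPoint 𝕜 x ↔ ‖x‖ = 1 ∧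
    ∀ (n : ℕ) (c : Fin n → ℝ) (φ : Fin n → StrongDual 𝕜 E) (a : Fin n → ℝ), (∀ i, 0 < c i) →
      ∑ i, c i = 1 → (∀ i, (halfBall (φ i) (a i)).Nonempty) →
      HasFarPoints x (combination 𝕜 c fun i => halfBall (φ i) (a i)) := by
  refine and_congr_right fun hx => ⟨fun h n c φ a hc hc1 hne => ?_, fun h C hC => ?_⟩
  · have hx0 : x ≠ 0 := norm_ne_zero_iff.1 (by simp [hx])
    choose S hSsub hS using fun i => exists_isSlice_subset_halfBall hx0 (hne i)
    have hC := isConvexCombOfSlices_iff.2 ⟨n, c, S, hc, hc1, hS, rfl⟩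
    exact ((supDistEqTwo_iff hx fun u => hC.norm_le).1 (h _ hC)).mono (combination_mono c hSsub)
  · refine (supDistEqTwo_iff hx fun u => hC.norm_le).2 ?_
    obtain ⟨n, c, S, hc, hc1, hS, rfl⟩ := isConvexCombOfSlices_iff.1 hC
    choose φ ε hφ hε hSeq using fun i => isSlice_iff.1 (hS i)
    obtain rfl : S = fun i => halfBall (φ i) (1 - ε i) := funext hSeq
    exact h n c φ _ hc hc1 fun i => exists_lt_re_apply _ (by linarith [hε i, hφ i])

end ConvexCombination

/-! ### Transfer of properties between a space and an `ℓ_∞`-summand -/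

/-- `J` embeds `Y` as an `ℓ_∞`-summand of `E`, with projection `R`. -/
structure IsMSummand {𝕜 : Type*} [RCLike 𝕜] {Y E : Type*} [NormedAddCommGroup Y]
    [NormedSpace 𝕜 Y] [NormedAddCommGroup E] [NormedSpace 𝕜 E] (J : Y →L[𝕜] E) (R : E →L[𝕜] Y) :
    Prop where
  left_inv : ∀ y, R (J y) = y
  norm_proj_le : ∀ w, ‖R w‖ ≤ ‖w‖
  norm_patch_le : ∀ w y, ‖w‖ ≤ 1 → ‖y‖ ≤ 1 → ‖w + J (y - R w)‖ ≤ 1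

namespace IsMSummand

variable {𝕜 : Type*} [RCLike 𝕜] {Y E : Type*} [NormedAddCommGroup Y] [NormedSpace 𝕜 Y]
  [NormedAddCommGroup E] [NormedSpace 𝕜 E] {J : Y →L[𝕜] E} {R : E →L[𝕜] Y} {f : E}

theorem proj_patch (h : IsMSummand J R) (w : E) (y : Y) : R (w + J (y - R w)) = y := by
  rw [map_add, h.left_inv, add_sub_cancel]

theorem norm_embed_le (h : IsMSummand J R) {y : Y} (hy : ‖y‖ ≤ 1) : ‖J y‖ ≤ 1 := by
  simpa using h.norm_patch_le 0 y (by simp) hy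

theorem le_norm_sub_patch (h : IsMSummand J R) (f w : E) (y : Y) :
    ‖R f - y‖ ≤ ‖f - (w + J (y - R w))‖ := by
  have := h.norm_proj_le (f - (w + J (y - R w)))
  rwa [map_sub R f, h.proj_patch] at this

theorem re_apply_patch (Φ : StrongDual 𝕜 E) (w : E) (y : Y) :
    RCLike.re (Φ (w + J (y - R w))) =
      RCLike.re (Φ w) + RCLike.re (Φ.comp J y) - RCLike.re (Φ.comp J (R w)) := by
  simp only [map_add, map_sub, ContinuousLinearMap.comp_apply]
  ring

/-- The patched element keeps the part `w - J (R w)` of `w` off the summand; the new threshold is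
`c` less the contribution of that part. -/
theorem patch_mem_halfBall (h : IsMSummand J R) {Φ : StrongDual 𝕜 E} {c : ℝ} {w : E} {y : Y}
    (hw : ‖w‖ ≤ 1)
    (hy : y ∈ halfBall (Φ.comp J) (c - RCLike.re (Φ w) + RCLike.re (Φ.comp J (R w)))) :
    w + J (y - R w) ∈ halfBall Φ c := by
  refine ⟨h.norm_patch_le w y hw hy.1, ?_⟩
  rw [re_apply_patch]
  linarith [hy.2]

theorem proj_mem_halfBall (h : IsMSummand J R) {Φ : StrongDual 𝕜 E} {c : ℝ} {w : E}
    (hw : w ∈ halfBall Φ c) :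
    R w ∈ halfBall (Φ.comp J) (c - RCLike.re (Φ w) + RCLike.re (Φ.comp J (R w))) :=
  ⟨(h.norm_proj_le w).trans hw.1, by linarith [hw.2]⟩

theorem hasFarPoints_of_patch (h : IsMSummand J R) {S : Set E} {S' : Set Y} {w : E}
    (hS : HasFarPoints (R f) S') (hSS' : ∀ y ∈ S', w + J (y - R w) ∈ S) : HasFarPoints f S :=
  fun ε hε =>
    let ⟨y, hy, hd⟩ := hS ε hε
    ⟨_, hSS' y hy, hd.trans (h.le_norm_sub_patch f w y)⟩

/-- If off the summand `f` is at distance at most `2 - η` from the ball, far points of `f` project to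
far points of `R f`. -/
theorem hasFarPoints_proj {η : ℝ} (hη : 0 < η)
    (hfar : ∀ w, ‖w‖ ≤ 1 → ‖f - w‖ ≤ max ‖R f - R w‖ (2 - η)) {S : Set E} {S' : Set Y}
    (hS : HasFarPoints f S) (hball : ∀ w ∈ S, ‖w‖ ≤ 1) (hSS' : ∀ w ∈ S, R w ∈ S') :
    HasFarPoints (R f) S' := fun ε hε => by
  -- A slack smaller than `η` rules out the second term of the maximum.
  obtain ⟨w, hw, hd⟩ := hS (min ε (η / 2)) (by positivity)
  refine ⟨R w, hSS' w hw, ?_⟩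
  have h1 := min_le_left ε (η / 2)
  have h2 := min_le_right ε (η / 2)
  rcases le_max_iff.1 (hd.trans (hfar w (hball w hw))) with h3 | h3 <;> linarith

theorem comp_proj_mem_halfBall (h : IsMSummand J R) {φ : StrongDual 𝕜 Y} {c : ℝ} {w : E}
    (hw : w ∈ halfBall (φ.comp R) c) : R w ∈ halfBall φ c :=
  ⟨(h.norm_proj_le w).trans hw.1, hw.2⟩

theorem embed_mem_halfBall (h : IsMSummand J R) {φ : StrongDual 𝕜 Y} {c : ℝ} {y : Y}
    (hy : y ∈ halfBall φ c) : J y ∈ halfBall (φ.comp R) c :=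
  ⟨h.norm_embed_le hy.1, by simpa [h.left_inv] using hy.2⟩

theorem isDaugavetPoint (h : IsMSummand J R) (hf : ‖f‖ = 1) (hR : IsDaugavetPoint 𝕜 (R f)) :
    IsDaugavetPoint 𝕜 f := by
  refine isDaugavetPoint_iff.2 ⟨hf, fun Φ c ⟨w, hw⟩ => ?_⟩
  exact h.hasFarPoints_of_patch ((isDaugavetPoint_iff.1 hR).2 _ _ ⟨_, h.proj_mem_halfBall hw⟩)
    fun y hy => h.patch_mem_halfBall hw.1 hy

theorem isDeltaPoint (h : IsMSummand J R) (hf : ‖f‖ = 1) (hR : IsDeltaPoint 𝕜 (R f)) :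
    IsDeltaPoint 𝕜 f := by
  refine isDeltaPoint_iff.2 ⟨hf, fun Φ c hw => ?_⟩
  exact h.hasFarPoints_of_patch ((isDeltaPoint_iff.1 hR).2 _ _ (h.proj_mem_halfBall hw))
    fun y hy => h.patch_mem_halfBall hw.1 hy

theorem isCcsDaugavetPoint (h : IsMSummand J R) (hf : ‖f‖ = 1)
    (hR : IsCcsDaugavetPoint 𝕜 (R f)) : IsCcsDaugavetPoint 𝕜 f := by
  refine isCcsDaugavetPoint_iff.2 ⟨hf, fun n c Φ a hc hc1 hne => ?_⟩
  choose w hw using hne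
  intro ε hε
  obtain ⟨_, ⟨y, hy, rfl⟩, hd⟩ := (isCcsDaugavetPoint_iff.1 hR).2 n c (fun i => (Φ i).comp J) _ hc
    hc1 (fun i => ⟨_, h.proj_mem_halfBall (hw i)⟩) ε hε
  refine ⟨_, ⟨_, fun i => h.patch_mem_halfBall (hw i).1 (hy i), rfl⟩, hd.trans ?_⟩
  refine le_trans (le_of_eq ?_) (h.norm_proj_le _)
  simp only [map_sub R f, map_sum, map_smul, h.proj_patch]

theorem isCcsDaugavetPoint_proj (h : IsMSummand J R) (hRf : ‖R f‖ = 1) {η : ℝ} (hη : 0 < η)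
    (hfar : ∀ w, ‖w‖ ≤ 1 → ‖f - w‖ ≤ max ‖R f - R w‖ (2 - η))
    (hf : IsCcsDaugavetPoint 𝕜 f) : IsCcsDaugavetPoint 𝕜 (R f) := by
  refine isCcsDaugavetPoint_iff.2 ⟨hRf, fun n c φ a hc hc1 hne => ?_⟩
  refine hasFarPoints_proj hη hfar ((isCcsDaugavetPoint_iff.1 hf).2 n c (fun i => (φ i).comp R) a
    hc hc1 fun i => ?_) ?_ ?_
  · obtain ⟨y, hy⟩ := hne i
    exact ⟨_, h.embed_mem_halfBall hy⟩
  · rintro _ ⟨w, hw, rfl⟩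
    exact norm_sum_smul_le_one hc hc1 fun i => (hw i).1
  · rintro _ ⟨w, hw, rfl⟩
    exact ⟨fun i => R (w i), fun i => h.comp_proj_mem_halfBall (hw i), by simp⟩

theorem norm_comp_proj (h : IsMSummand J R) (φ : StrongDual 𝕜 Y) : ‖φ.comp R‖ = ‖φ‖ := by
  refine le_antisymm ?_ ?_
  · refine (φ.opNorm_comp_le R).trans (mul_le_of_le_one_right (norm_nonneg _) ?_)
    exact R.opNorm_le_bound zero_le_one fun w => by simpa using h.norm_proj_le w
  · refine le_of_forall_lt fun r hr => ?_
    obtain ⟨y, hy⟩ := exists_lt_re_apply φ hr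
    exact (h.embed_mem_halfBall hy).2.trans_le (re_apply_le_norm _ (h.embed_mem_halfBall hy).1)

theorem isCcsDeltaPoint_proj (h : IsMSummand J R) (hRf : ‖R f‖ = 1) {η : ℝ} (hη : 0 < η)
    (hfar : ∀ w, ‖w‖ ≤ 1 → ‖f - w‖ ≤ max ‖R f - R w‖ (2 - η))
    (hf : IsCcsDeltaPoint 𝕜 f) : IsCcsDeltaPoint 𝕜 (R f) := by
  refine ⟨hRf, fun C hC hmem => (supDistEqTwo_iff hRf fun u => hC.norm_le).2 ?_⟩
  obtain ⟨n, c, S, hc, hc1, hS, rfl⟩ := isConvexCombOfSlices_iff.1 hC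
  choose φ ε hφ hε hSeq using fun i => isSlice_iff.1 (hS i)
  obtain rfl : S = fun i => halfBall (φ i) (1 - ε i) := funext hSeq
  have hC' : IsConvexCombOfSlices 𝕜 (Metric.closedBall 0 1)
      (combination 𝕜 c fun i => halfBall ((φ i).comp R) (1 - ε i)) :=
    isConvexCombOfSlices_iff.2 ⟨n, c, _, hc, hc1, fun i =>
      isSlice_iff.2 ⟨_, _, (h.norm_comp_proj _).trans (hφ i), hε i, rfl⟩, rfl⟩
  have hmem' : f ∈ combination 𝕜 c fun i => halfBall ((φ i).comp R) (1 - ε i) := by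
    obtain ⟨y, hy, hsum⟩ := hmem
    -- Each `y i` is patched into `f` itself; as the `y i` average to `R f`, the corrections average
    -- to zero and the combination is `f`.
    refine ⟨fun i => f + J (y i - R f), fun i =>
      ⟨h.norm_patch_le f _ hf.1.le (hy i).1, ?_⟩, ?_⟩
    · rw [ContinuousLinearMap.comp_apply, h.proj_patch]
      exact (hy i).2
    · have hc1' : ∑ i, ((c i : ℝ) : 𝕜) = 1 := by
        rw [← RCLike.ofReal_sum, hc1, RCLike.ofReal_one]
      simp only [smul_add, Finset.sum_add_distrib, ← Finset.sum_smul, hc1', one_smul,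
        map_sub, smul_sub, Finset.sum_sub_distrib]
      simp only [← map_smul, ← map_sum, ← hsum, sub_self, add_zero]
  refine hasFarPoints_proj hη hfar ((supDistEqTwo_iff hf.1 fun u => hC'.norm_le).1
    (hf.2 _ hC' hmem')) (fun w => hC'.norm_le) ?_
  rintro _ ⟨w, hw, rfl⟩
  exact ⟨fun i => R (w i), fun i => h.comp_proj_mem_halfBall (hw i), by simp⟩

theorem isDaugavetPoint_proj (h : IsMSummand J R) (hRf : ‖R f‖ = 1) {η : ℝ} (hη : 0 < η)
    (hfar : ∀ w, ‖w‖ ≤ 1 → ‖f - w‖ ≤ max ‖R f - R w‖ (2 - η))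
    (hf : IsDaugavetPoint 𝕜 f) : IsDaugavetPoint 𝕜 (R f) := by
  refine isDaugavetPoint_iff.2 ⟨hRf, fun φ c ⟨y, hy⟩ => ?_⟩
  exact hasFarPoints_proj hη hfar
    ((isDaugavetPoint_iff.1 hf).2 (φ.comp R) c ⟨_, h.embed_mem_halfBall hy⟩)
    (fun w hw => hw.1) fun w hw => h.comp_proj_mem_halfBall hw

theorem isDeltaPoint_proj (h : IsMSummand J R) (hRf : ‖R f‖ = 1) {η : ℝ} (hη : 0 < η)
    (hfar : ∀ w, ‖w‖ ≤ 1 → ‖f - w‖ ≤ max ‖R f - R w‖ (2 - η))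
    (hf : IsDeltaPoint 𝕜 f) : IsDeltaPoint 𝕜 (R f) := by
  refine isDeltaPoint_iff.2 ⟨hRf, fun φ c hy => ?_⟩
  exact hasFarPoints_proj hη hfar
    ((isDeltaPoint_iff.1 hf).2 (φ.comp R) c ⟨hf.1.le, hy.2⟩)
    (fun w hw => hw.1) fun w hw => h.comp_proj_mem_halfBall hw

theorem isNablaPoint_proj (h : IsMSummand J R) (hRf : ‖R f‖ = 1) {η : ℝ} (hη : 0 < η)
    (hfar : ∀ w, ‖w‖ ≤ 1 → ‖f - w‖ ≤ max ‖R f - R w‖ (2 - η))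
    (hf : IsNablaPoint 𝕜 f) : IsNablaPoint 𝕜 (R f) := by
  refine isNablaPoint_iff.2 ⟨hRf, fun φ c hfc ⟨y, hy⟩ => ?_⟩
  exact hasFarPoints_proj hη hfar
    ((isNablaPoint_iff.1 hf).2 (φ.comp R) c hfc ⟨_, h.embed_mem_halfBall hy⟩)
    (fun w hw => hw.1) fun w hw => h.comp_proj_mem_halfBall hw

/-- When the summand is everything, patching leaves the threshold at `c`, so `R f` stays outside the
half ball as a ∇ point requires. -/
theorem isNablaPoint (h : IsMSummand J R) (hJR : ∀ w, J (R w) = w) (hf : ‖f‖ = 1)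
    (hR : IsNablaPoint 𝕜 (R f)) : IsNablaPoint 𝕜 f := by
  refine isNablaPoint_iff.2 ⟨hf, fun Φ c hfc ⟨w, hw⟩ => ?_⟩
  refine h.hasFarPoints_of_patch ((isNablaPoint_iff.1 hR).2 _ _ ?_ ⟨_, h.proj_mem_halfBall hw⟩)
    fun y hy => h.patch_mem_halfBall hw.1 hy
  simp only [ContinuousLinearMap.comp_apply, hJR]
  linarith

/-- A `∇` point whose norm is not attained off the summand is Daugavet in the summand. -/
theorem isDaugavetPoint_proj_of_isNablaPoint (h : IsMSummand J R) (hRf : ‖R f‖ = 1) {η : ℝ}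
    (hη : 0 < η) (hfar : ∀ w, ‖w‖ ≤ 1 → ‖f - w‖ ≤ max ‖R f - R w‖ (2 - η))
    {ψ : StrongDual 𝕜 E} (hψJ : ∀ y, ψ (J y) = 0) (hψ : ‖ψ‖ = 1)
    (hψf : RCLike.re (ψ f) ≤ 1 - η) (hf : IsNablaPoint 𝕜 f) : IsDaugavetPoint 𝕜 (R f) := by
  refine ⟨hRf, fun S hS => (supDistEqTwo_iff hRf fun u => norm_le_of_mem_slice hS).2 ?_⟩
  obtain ⟨φ, ε, hφ, hε, rfl⟩ := isSlice_iff.1 hS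
  have h1 := min_le_left ε η
  have h2 := min_le_right ε η
  have h0 : 0 < min ε η := by positivity
  -- The deficit `η` of `ψ` at `f` keeps `f` out of this half ball. Since `ψ` contributes at most 1,
  -- its elements project into the given slice. It is nonempty because `ψ` vanishes on the summand,
  -- so both functionals can be nearly normed at once.
  refine hasFarPoints_proj hη hfar ((isNablaPoint_iff.1 hf).2 (φ.comp R + ψ) (2 - min ε η) ?_ ?_)
    (fun w hw => hw.1) fun w hw => ⟨(h.norm_proj_le w).trans hw.1, ?_⟩
  · have := re_apply_le_norm φ hRf.le
    simp only [add_apply, ContinuousLinearMap.comp_apply, map_add]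
    linarith
  · obtain ⟨y, hy, hy'⟩ := exists_lt_re_apply φ (r := 1 - min ε η / 2) (by linarith)
    obtain ⟨w, hw, hw'⟩ := exists_lt_re_apply ψ (r := 1 - min ε η / 2) (by linarith)
    refine ⟨w + J (y - R w), h.norm_patch_le w y hw hy, ?_⟩
    simp only [add_apply, ContinuousLinearMap.comp_apply, h.proj_patch,
      map_add ψ, hψJ, add_zero, map_add (RCLike.re : 𝕜 →+ ℝ)]
    linarith
  · have := re_apply_le_norm ψ hw.1
    have hw2 := hw.2
    simp only [add_apply, ContinuousLinearMap.comp_apply, map_add] at hw2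
    linarith

/-- Patching a fixed `w` is an affine weakly continuous map of `y`. -/
theorem isRelWeaklyOpen_patch (h : IsMSummand J R) {W : Set E}
    (hW : IsRelWeaklyOpen 𝕜 (Metric.closedBall 0 1) W) {w : E} (hw : ‖w‖ ≤ 1) :
    IsRelWeaklyOpen 𝕜 (Metric.closedBall 0 1) {y | ‖y‖ ≤ 1 ∧ w + J (y - R w) ∈ W} := by
  obtain ⟨U, hU, rfl⟩ := hW
  refine ⟨(fun y => toWeakSpace 𝕜 E (w - J (R w)) + WeakSpace.map J y) ⁻¹' U,
    hU.preimage (by fun_prop), ?_⟩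
  ext y
  have : toWeakSpace 𝕜 E (w + J (y - R w)) =
      toWeakSpace 𝕜 E (w - J (R w)) + WeakSpace.map J (toWeakSpace 𝕜 Y y) := by
    change w + J (y - R w) = w - J (R w) + J y
    rw [map_sub]
    abel
  simp only [Set.mem_ofPred_eq, mem_closedBall_zero_iff, Set.mem_preimage, this]
  exact and_congr_right fun hy => and_iff_right (h.norm_patch_le w y hw hy)

theorem isRelWeaklyOpen_preimage {W : Set Y}
    (hW : IsRelWeaklyOpen 𝕜 (Metric.closedBall 0 1) W) (h : IsMSummand J R) :
    IsRelWeaklyOpen 𝕜 (Metric.closedBall 0 1) {w : E | ‖w‖ ≤ 1 ∧ R w ∈ W} := by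
  obtain ⟨U, hU, rfl⟩ := hW
  refine ⟨WeakSpace.map R ⁻¹' U, hU.preimage (WeakSpace.map R).continuous, ?_⟩
  ext w
  simp only [Set.mem_ofPred_eq, mem_closedBall_zero_iff, Set.mem_preimage]
  exact and_congr_right fun hw => and_iff_right ((h.norm_proj_le w).trans hw)

end IsMSummand

theorem IsRelWeaklyOpen.norm_le {𝕜 : Type*} [RCLike 𝕜] {E : Type*} [NormedAddCommGroup E]
    [NormedSpace 𝕜 E] {W : Set E} (hW : IsRelWeaklyOpen 𝕜 (Metric.closedBall 0 1) W) {u : E}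
    (hu : u ∈ W) : ‖u‖ ≤ 1 := by
  obtain ⟨U, -, rfl⟩ := hW
  simpa using hu.1

namespace IsMSummand

variable {𝕜 : Type*} [RCLike 𝕜] {Y E : Type*} [NormedAddCommGroup Y] [NormedSpace 𝕜 Y]
  [NormedAddCommGroup E] [NormedSpace 𝕜 E] {J : Y →L[𝕜] E} {R : E →L[𝕜] Y} {f : E}

theorem isSuperDaugavetPoint (h : IsMSummand J R) (hf : ‖f‖ = 1)
    (hR : IsSuperDaugavetPoint 𝕜 (R f)) : IsSuperDaugavetPoint 𝕜 f := by
  refine ⟨hf, fun W hW ⟨w, hw⟩ => (supDistEqTwo_iff hf fun u => hW.norm_le).2 ?_⟩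
  have hw1 := hW.norm_le hw
  have hW' := h.isRelWeaklyOpen_patch hW hw1
  refine h.hasFarPoints_of_patch (w := w) ((supDistEqTwo_iff hR.1 fun u => hW'.norm_le).1
    (hR.2 _ hW' ⟨R w, (h.norm_proj_le w).trans hw1, ?_⟩)) fun y hy => hy.2
  simpa using hw

theorem isSuperDeltaPoint (h : IsMSummand J R) (hf : ‖f‖ = 1)
    (hR : IsSuperDeltaPoint 𝕜 (R f)) : IsSuperDeltaPoint 𝕜 f := by
  refine ⟨hf, fun W hW hw => (supDistEqTwo_iff hf fun u => hW.norm_le).2 ?_⟩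
  have hW' := h.isRelWeaklyOpen_patch hW hf.le
  refine h.hasFarPoints_of_patch (w := f) ((supDistEqTwo_iff hR.1 fun u => hW'.norm_le).1
    (hR.2 _ hW' ⟨hR.1.le, ?_⟩)) fun y hy => hy.2
  simpa using hw

theorem isSuperDaugavetPoint_proj (h : IsMSummand J R) (hRf : ‖R f‖ = 1) {η : ℝ} (hη : 0 < η)
    (hfar : ∀ w, ‖w‖ ≤ 1 → ‖f - w‖ ≤ max ‖R f - R w‖ (2 - η))
    (hf : IsSuperDaugavetPoint 𝕜 f) : IsSuperDaugavetPoint 𝕜 (R f) := by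
  refine ⟨hRf, fun W hW ⟨y, hy⟩ => (supDistEqTwo_iff hRf fun u => hW.norm_le).2 ?_⟩
  have hW' := isRelWeaklyOpen_preimage hW h
  refine hasFarPoints_proj hη hfar ((supDistEqTwo_iff hf.1 fun u => hW'.norm_le).1
    (hf.2 _ hW' ⟨J y, h.norm_embed_le (hW.norm_le hy), ?_⟩)) (fun w hw => hw.1) fun w hw => hw.2
  rwa [h.left_inv]

theorem isSuperDeltaPoint_proj (h : IsMSummand J R) (hRf : ‖R f‖ = 1) {η : ℝ} (hη : 0 < η)
    (hfar : ∀ w, ‖w‖ ≤ 1 → ‖f - w‖ ≤ max ‖R f - R w‖ (2 - η))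
    (hf : IsSuperDeltaPoint 𝕜 f) : IsSuperDeltaPoint 𝕜 (R f) := by
  refine ⟨hRf, fun W hW hy => (supDistEqTwo_iff hRf fun u => hW.norm_le).2 ?_⟩
  have hW' := isRelWeaklyOpen_preimage hW h
  exact hasFarPoints_proj hη hfar ((supDistEqTwo_iff hf.1 fun u => hW'.norm_le).1
    (hf.2 _ hW' ⟨hf.1.le, hy⟩)) (fun w hw => hw.1) fun w hw => hw.2

end IsMSummand

/-! ### Rotation of slices over the complex field -/

section Complex

variable {𝕜 : Type*} [RCLike 𝕜] {E : Type*} [NormedAddCommGroup E] [NormedSpace 𝕜 E]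

theorem RCLike.im_I_of_ne_zero (hI : (RCLike.I : 𝕜) ≠ 0) : RCLike.im (RCLike.I : 𝕜) = 1 := by
  have h := RCLike.mul_im_I_ax (RCLike.I : 𝕜)
  have h0 : RCLike.im (RCLike.I : 𝕜) ≠ 0 := fun h0 =>
    hI (RCLike.ext (by simp) (by simp [h0]))
  exact mul_right_cancel₀ h0 (by rw [h, one_mul])

/-- Over the complex field the `∇` points are the Daugavet points. -/
theorem IsNablaPoint.isDaugavetPoint_of_I_ne_zero (hI : (RCLike.I : 𝕜) ≠ 0) {x : E}
    (h : IsNablaPoint 𝕜 x) : IsDaugavetPoint 𝕜 x := by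
  have hx := h.1
  refine ⟨hx, fun S hS => (supDistEqTwo_iff hx fun u => norm_le_of_mem_slice hS).2 ?_⟩
  obtain ⟨φ, α, hφ, hα, rfl⟩ := isSlice_iff.1 hS
  have hnorm : ∀ u, ‖u‖ ≤ 1 → RCLike.re (φ u) ^ 2 + RCLike.im (φ u) ^ 2 ≤ 1 := fun u hu => by
    have h1 : ‖φ u‖ ≤ 1 := by
      have := φ.le_of_opNorm_le hφ.le u
      linarith
    have h2 := RCLike.norm_sq_eq_def (z := φ u)
    nlinarith [norm_nonneg (φ u)]
  rcases lt_or_ge (RCLike.re (φ x)) 1 with hlt | hge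
  -- If `φ` does not attain its norm at `x`, a thinner slice already misses `x`.
  · have h1 := min_le_left α (1 - RCLike.re (φ x))
    have h2 := min_le_right α (1 - RCLike.re (φ x))
    have h0 : 0 < min α (1 - RCLike.re (φ x)) := lt_min hα (by linarith)
    refine ((isNablaPoint_iff.1 h).2 φ (1 - min α (1 - RCLike.re (φ x))) (by linarith)
      (exists_lt_re_apply φ (by linarith))).mono fun u hu => ⟨hu.1, ?_⟩
    linarith [hu.2]
  -- Now `φ x = 1`. Write `a = cos τ`. After rotation by the angle `τ`, the half ball at height `a`
  -- misses `x`, and on it the argument of `φ u` is less than `2τ` in absolute value, which gives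
  -- `re (φ u) > cos 2τ = 2 * a ^ 2 - 1`.
  · obtain ⟨a, ha0, ha1, haα⟩ : ∃ a : ℝ, 0 < a ∧ a < 1 ∧ 1 - α ≤ 2 * a ^ 2 - 1 := by
      have h1 := min_le_left (1 / 2) (α / 4)
      have h2 := min_le_right (1 / 2) (α / 4)
      have h0 : 0 < min (1 / 2) (α / 4) := by positivity
      exact ⟨1 - min (1 / 2) (α / 4), by linarith, by linarith, by nlinarith⟩
    obtain ⟨b, hb0, hab⟩ : ∃ b : ℝ, 0 ≤ b ∧ a ^ 2 + b ^ 2 = 1 :=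
      ⟨√(1 - a ^ 2), Real.sqrt_nonneg _, by rw [Real.sq_sqrt (by nlinarith)]; ring⟩
    set θ : 𝕜 := (a : 𝕜) + (b : 𝕜) * RCLike.I with hθ
    have hθre : RCLike.re θ = a := by simp [hθ]
    have hθim : RCLike.im θ = b := by simp [hθ, RCLike.im_I_of_ne_zero hI]
    have hθnorm : ‖θ‖ = 1 := by
      have := RCLike.norm_sq_eq_def (z := θ)
      rw [hθre, hθim] at this
      nlinarith [norm_nonneg θ]
    have hre : ∀ u, RCLike.re ((θ • φ) u) = a * RCLike.re (φ u) - b * RCLike.im (φ u) := fun u => by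
      rw [smul_apply, smul_eq_mul, RCLike.mul_re, hθre, hθim]
    have hφθ : ‖θ • φ‖ = 1 := by rw [norm_smul, hθnorm, hφ, one_mul]
    refine ((isNablaPoint_iff.1 h).2 (θ • φ) a ?_
      (exists_lt_re_apply _ (by linarith))).mono fun u hu => ⟨hu.1, ?_⟩
    · have h1 := hnorm x hx.le
      have h2 : RCLike.im (φ x) = 0 := by nlinarith
      have h3 : RCLike.re (φ x) ≤ 1 := by nlinarith
      rw [hre, h2]
      nlinarith
    · have h1 := hnorm u hu.1
      have h2 := hu.2
      rw [hre] at h2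
      set r := RCLike.re (φ u)
      set m := RCLike.im (φ u)
      -- The square on the left is that of the imaginary part of `θ * φ u`, whose real part exceeds
      -- `a`.
      have h3 : (b * r + a * m) ^ 2 < b ^ 2 := by
        have : (a * r - b * m) ^ 2 + (b * r + a * m) ^ 2 = r ^ 2 + m ^ 2 := by
          linear_combination (r ^ 2 + m ^ 2) * hab
        nlinarith
      have h4 := (abs_lt_of_sq_lt_sq' h3 hb0).1
      have h5 : r = a * (a * r - b * m) + b * (b * r + a * m) := by
        linear_combination (-r) * hab
      nlinarith

end Complex

/-! ### Finite `ℓ_∞`-sums -/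

section Pi

variable {𝕜 : Type*} [RCLike 𝕜] {X : Type*} [NormedAddCommGroup X] [NormedSpace 𝕜 X]
  {ι : Type*} [Fintype ι]

theorem isMSummand_single [DecidableEq ι] (k : ι) :
    IsMSummand (ContinuousLinearMap.single 𝕜 (fun _ : ι => X) k)
      (ContinuousLinearMap.proj (R := 𝕜) (φ := fun _ : ι => X) k) where
  left_inv y := by simp
  norm_proj_le w := norm_le_pi_norm w k
  norm_patch_le w y hw hy := by
    refine (pi_norm_le_iff_of_nonneg zero_le_one).2 fun j => ?_
    rcases eq_or_ne j k with rfl | hj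
    · simpa using hy
    · simpa [hj] using (norm_le_pi_norm w j).trans hw

theorem re_apply_eq_sum_single [DecidableEq ι] (Φ : StrongDual 𝕜 (ι → X)) (u : ι → X) : RCLike.re (Φ u) =
    ∑ k, RCLike.re (Φ.comp (ContinuousLinearMap.single 𝕜 (fun _ : ι => X) k) (u k)) := by
  rw [← map_sum]
  simp only [ContinuousLinearMap.comp_apply, ContinuousLinearMap.single_apply, ← map_sum,
    Finset.univ_sum_single]

theorem exists_pi_functional (φ : ι → StrongDual 𝕜 X) (β : ι → ℝ) :
    ∃ Φ : StrongDual 𝕜 (ι → X), ∀ u, RCLike.re (Φ u) = ∑ k, (β k)⁻¹ * RCLike.re (φ k (u k)) := by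
  refine ⟨∑ k, (((β k)⁻¹ : ℝ) : 𝕜) • (φ k).comp (ContinuousLinearMap.proj k), fun u => ?_⟩
  simp only [sum_apply, smul_apply, ContinuousLinearMap.comp_apply,
    ContinuousLinearMap.proj_apply, smul_eq_mul, map_sum, RCLike.re_ofReal_mul]

/-- A deficit below `β k / N` in each of the `N` coordinates adds up to a weighted deficit below 1.
-/
theorem halfBall_pi_nonempty [Nonempty ι] {φ : ι → StrongDual 𝕜 X} {β : ι → ℝ}
    (hφ : ∀ k, ‖φ k‖ = 1) (hβ : ∀ k, 0 < β k) {Φ : StrongDual 𝕜 (ι → X)}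
    (hΦ : ∀ u, RCLike.re (Φ u) = ∑ k, (β k)⁻¹ * RCLike.re (φ k (u k))) :
    (halfBall Φ (∑ k, (β k)⁻¹ - 1)).Nonempty := by
  have hN : (0 : ℝ) < Fintype.card ι := by exact_mod_cast Fintype.card_pos
  choose u hu hlt using fun k => exists_lt_re_apply (φ k) (r := 1 - β k / Fintype.card ι) (by
    rw [hφ]
    have := div_pos (hβ k) hN
    linarith)
  refine ⟨u, (pi_norm_le_iff_of_nonneg zero_le_one).2 hu, ?_⟩
  have h : ∑ k, ((β k)⁻¹ - (Fintype.card ι : ℝ)⁻¹) < ∑ k, (β k)⁻¹ * RCLike.re (φ k (u k)) := by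
    refine Finset.sum_lt_sum_of_nonempty Finset.univ_nonempty fun k _ => ?_
    have hk := hβ k
    calc (β k)⁻¹ - (Fintype.card ι : ℝ)⁻¹ = (β k)⁻¹ * (1 - β k / Fintype.card ι) := by field_simp
      _ < _ := by gcongr; exact hlt k
  rw [Finset.sum_sub_distrib, Finset.sum_const, Finset.card_univ, nsmul_eq_mul,
    mul_inv_cancel₀ hN.ne'] at h
  rwa [hΦ]

/-- In this half ball the deficits `1 - re (φ k (u k))`, measured in units of `β k`, are nonnegative
and sum to less than 1. Each is therefore less than 1, so every coordinate lies in its own slice;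
finiteness makes the gap below 2 uniform. -/
theorem not_hasFarPoints_pi [Nonempty ι] {x : ι → X} {φ : ι → StrongDual 𝕜 X} {β : ι → ℝ}
    (hφ : ∀ k, ‖φ k‖ = 1) (hβ : ∀ k, 0 < β k)
    (h : ∀ k, ¬ HasFarPoints (x k) (halfBall (φ k) (1 - β k))) {Φ : StrongDual 𝕜 (ι → X)}
    (hΦ : ∀ u, RCLike.re (Φ u) = ∑ k, (β k)⁻¹ * RCLike.re (φ k (u k))) :
    ¬ HasFarPoints x (halfBall Φ (∑ k, (β k)⁻¹ - 1)) := by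
  choose ε hε hfar using fun k => not_hasFarPoints.1 (h k)
  obtain ⟨k₀, hk₀⟩ := Finite.exists_min ε
  intro hx
  obtain ⟨u, ⟨hu, hlt⟩, hd⟩ := hx (ε k₀ / 2) (half_pos (hε k₀))
  have hle : ‖x - u‖ ≤ 2 - ε k₀ := by
    refine (pi_norm_le_iff_of_nonempty _).2 fun k => ?_
    have hnn : ∀ j, 0 ≤ (β j)⁻¹ * (1 - RCLike.re (φ j (u j))) := fun j =>
      mul_nonneg (inv_nonneg.2 (hβ j).le) (by
        have := re_apply_le_norm (φ j) ((norm_le_pi_norm u j).trans hu)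
        linarith [hφ j])
    have hs := Finset.single_le_sum (fun j _ => hnn j) (Finset.mem_univ k)
    simp only [mul_sub, mul_one, Finset.sum_sub_distrib, ← hΦ] at hs
    have hk : (β k)⁻¹ * (1 - RCLike.re (φ k (u k))) < 1 := by linarith
    rw [inv_mul_lt_iff₀ (hβ k)] at hk
    have := hfar k (u k) ⟨(norm_le_pi_norm u k).trans hu, by linarith⟩
    simp only [Pi.sub_apply]
    linarith [hk₀ k]
  linarith [hε k₀]

variable [Nonempty ι] {x : ι → X}

theorem norm_eq_one_of_forall (hx : ∀ k, ‖x k‖ = 1) : ‖x‖ = 1 :=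
  le_antisymm ((pi_norm_le_iff_of_nonneg zero_le_one).2 fun k => (hx k).le)
    ((hx (Classical.arbitrary ι)).symm.le.trans (norm_le_pi_norm x _))

theorem exists_not_hasFarPoints {y : X} (hy : ‖y‖ = 1) (h : ¬ IsDaugavetPoint 𝕜 y) :
    ∃ (φ : StrongDual 𝕜 X) (β : ℝ), ‖φ‖ = 1 ∧ 0 < β ∧ ¬ HasFarPoints y (halfBall φ (1 - β)) := by
  by_contra! hall
  refine h ⟨hy, fun S hS => (supDistEqTwo_iff hy fun u => norm_le_of_mem_slice hS).2 ?_⟩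
  obtain ⟨φ, β, hφ, hβ, rfl⟩ := isSlice_iff.1 hS
  exact hall φ β hφ hβ

theorem exists_not_hasFarPoints_of_not_isNablaPoint {y : X} (hy : ‖y‖ = 1)
    (h : ¬ IsNablaPoint 𝕜 y) : ∃ (φ : StrongDual 𝕜 X) (β : ℝ), ‖φ‖ = 1 ∧ 0 < β ∧
      ¬ HasFarPoints y (halfBall φ (1 - β)) ∧ RCLike.re (φ y) ≤ 1 - β := by
  by_contra! hall
  refine h ⟨hy, fun S hS hyS => (supDistEqTwo_iff hy fun u => norm_le_of_mem_slice hS).2 ?_⟩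
  obtain ⟨φ, β, hφ, hβ, rfl⟩ := isSlice_iff.1 hS
  by_contra hfar
  exact hyS ⟨hy.le, hall φ β hφ hβ hfar⟩

theorem isDaugavetPoint_pi_iff (hx : ∀ k, ‖x k‖ = 1) :
    IsDaugavetPoint 𝕜 x ↔ ∃ k, IsDaugavetPoint 𝕜 (x k) := by
  classical
  constructor
  · intro h
    by_contra! hno
    choose φ β hφ hβ hfar using fun k => exists_not_hasFarPoints (hx k) (hno k)
    obtain ⟨Φ, hΦ⟩ := exists_pi_functional φ β
    exact not_hasFarPoints_pi hφ hβ hfar hΦ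
      ((isDaugavetPoint_iff.1 h).2 _ _ (halfBall_pi_nonempty hφ hβ hΦ))
  · rintro ⟨k, hk⟩
    exact (isMSummand_single k).isDaugavetPoint (norm_eq_one_of_forall hx) hk

/-- If all coordinates fail, take `β k = p k * α k`. The deficit of `x k` is below `α k`, so the
weighted deficit of `x` is below `∑ 1 / p k = 1` and `x` lies in the product half ball. -/
theorem IsDeltaPoint.exists_isDeltaPPoint {p : ι → ℝ} (hx : ∀ k, ‖x k‖ = 1)
    (hp : ∀ k, 0 < p k) (hp1 : ∑ k, 1 / p k = 1) (h : IsDeltaPoint 𝕜 x) :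
    ∃ k, IsDeltaPPoint 𝕜 (p k) (x k) := by
  by_contra! hno
  simp only [isDeltaPPoint_iff, hx, true_and, not_forall, exists_prop] at hno
  choose φ α hφ hα hmem hfar using hno
  have hβ : ∀ k, 0 < p k * α k := fun k => mul_pos (hp k) (hα k)
  obtain ⟨Φ, hΦ⟩ := exists_pi_functional φ fun k => p k * α k
  refine not_hasFarPoints_pi hφ hβ hfar hΦ
    ((isDeltaPoint_iff.1 h).2 _ _ ⟨(norm_eq_one_of_forall hx).le, ?_⟩)
  rw [hΦ, ← hp1, ← Finset.sum_sub_distrib]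
  refine Finset.sum_lt_sum_of_nonempty Finset.univ_nonempty fun k _ => ?_
  have hk := hβ k
  have hpk := hp k
  have hαk := hα k
  calc (p k * α k)⁻¹ - 1 / p k = (p k * α k)⁻¹ * (1 - α k) := by field_simp
    _ < _ := by gcongr; exact (hmem k).2

theorem isDeltaPoint_pi_of_exists_isDeltaPPoint (hx : ∀ k, ‖x k‖ = 1)
    (hcard : 2 ≤ Fintype.card ι)
    (h : ∀ p : ι → ℝ, (∀ k, 1 < p k) → ∑ k, 1 / p k = 1 → ∃ k, IsDeltaPPoint 𝕜 (p k) (x k)) :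
    IsDeltaPoint 𝕜 x := by
  classical
  refine isDeltaPoint_iff.2 ⟨norm_eq_one_of_forall hx, fun Φ c hxc => ?_⟩
  set N : ℝ := (Fintype.card ι : ℝ) with hN_def
  have hN : 0 < N := by
    rw [hN_def]
    exact_mod_cast Fintype.card_pos
  have hconst : ∀ r : ℝ, ∑ _k : ι, r / N = r := fun r => by
    rw [Finset.sum_const, Finset.card_univ, nsmul_eq_mul, ← hN_def]
    field_simp
  set φ : ι → StrongDual 𝕜 X := fun k =>
    Φ.comp (ContinuousLinearMap.single 𝕜 (fun _ : ι => X) k) with hφ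
  have hΦ : ∀ u : ι → X, RCLike.re (Φ u) = ∑ k, RCLike.re (φ k (u k)) := re_apply_eq_sum_single Φ
  set s : ℝ := RCLike.re (Φ x) - c with hs
  have hs0 : 0 < s := sub_pos.2 hxc.2
  have hsN : 0 < s / N := div_pos hs0 hN
  -- The deficit of `x` in coordinate `k`, plus an equal share of the slack `s`; these add up to the
  -- total deficit `A` allowed by the half ball.
  set α : ι → ℝ := fun k => ‖φ k‖ - RCLike.re (φ k (x k)) + s / N with hα
  have hα0 : ∀ k, 0 < α k := fun k => by
    have := re_apply_le_norm (φ k) (hx k).le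
    simp only [hα]
    linarith
  set A : ℝ := ∑ k, α k with hA
  have hAc : A = ∑ k, ‖φ k‖ - c := by
    simp only [hA, hα, Finset.sum_add_distrib, Finset.sum_sub_distrib, hconst, ← hΦ, hs]
    ring
  have hA0 : 0 < A := Finset.sum_pos (fun k _ => hα0 k) Finset.univ_nonempty
  have hlt : ∀ k, α k < A := fun k => by
    obtain ⟨j, hj⟩ := Fintype.exists_ne_of_one_lt_card hcard k
    exact Finset.single_lt_sum hj (Finset.mem_univ k) (Finset.mem_univ j) (hα0 j)
      fun i _ _ => (hα0 i).le
  -- With this exponent, `p k * α k = A`: coordinate `k` may spend the entire allowance. A second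
  -- coordinate is what makes `p k > 1`.
  obtain ⟨k, hk⟩ := h (fun k => A / α k) (fun k => (one_lt_div (hα0 k)).2 (hlt k)) (by
    simp only [one_div_div, ← Finset.sum_div]
    exact div_self hA0.ne')
  have hfar := hk.hasFarPoints (φ := φ k) (hα0 k) ⟨(hx k).le, by simp only [hα]; linarith⟩
    (div_pos hA0 (hα0 k))
  rw [div_mul_cancel₀ _ (hα0 k).ne'] at hfar
  intro ε hε
  obtain ⟨v, ⟨hv, hvlt⟩, hd⟩ := hfar ε hε
  set r : ℝ := RCLike.re (φ k v) - (‖φ k‖ - A) with hr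
  have hr0 : 0 < r := sub_pos.2 hvlt
  have hrN : 0 < r / N := div_pos hr0 hN
  -- The allowance `r` left over by `v` is split equally, and the other coordinates nearly norm
  -- their functionals.
  choose y hy hylt using fun j => exists_lt_re_apply (φ j) (sub_lt_self ‖φ j‖ hrN)
  refine ⟨Function.update y k v, ⟨(pi_norm_le_iff_of_nonneg zero_le_one).2 fun j => ?_, ?_⟩, ?_⟩
  · rcases eq_or_ne j k with rfl | hj
    · simpa using hv
    · simpa [hj] using hy j
  · have hsum : ∑ j, (‖φ j‖ - r / N - if j = k then A - r else 0) <
        ∑ j, RCLike.re (φ j (Function.update y k v j)) := by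
      refine Finset.sum_lt_sum_of_nonempty Finset.univ_nonempty fun j _ => ?_
      rcases eq_or_ne j k with rfl | hj
      · simp only [if_true, Function.update_self]
        linarith
      · simpa [hj] using hylt j
    simp only [Finset.sum_sub_distrib, hconst, Finset.sum_ite_eq', Finset.mem_univ, if_true] at hsum
    rw [hΦ]
    linarith
  · refine hd.trans (le_trans (le_of_eq ?_) (norm_le_pi_norm _ k))
    simp

/-- With a single coordinate no `p > 1` has `1 / p = 1`, so the condition on exponents would hold
vacuously; hence the bound on the cardinality. -/
theorem isDeltaPoint_pi_iff (hx : ∀ k, ‖x k‖ = 1) :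
    IsDeltaPoint 𝕜 x ↔ (∃ k, IsDeltaPoint 𝕜 (x k)) ∨ (2 ≤ Fintype.card ι ∧
      ∀ p : ι → ℝ, (∀ k, 1 < p k) → ∑ k, 1 / p k = 1 → ∃ k, IsDeltaPPoint 𝕜 (p k) (x k)) := by
  classical
  constructor
  · intro h
    rcases lt_or_ge (Fintype.card ι) 2 with hcard | hcard
    · have hsub : Subsingleton ι := Fintype.card_le_one_iff_subsingleton.1 (by omega)
      have k : ι := Classical.arbitrary ι
      refine Or.inl ⟨k, (isMSummand_single k).isDeltaPoint_proj (hx k) one_pos (fun w hw => ?_) h⟩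
      refine le_max_of_le_left ((pi_norm_le_iff_of_nonempty _).2 fun j => ?_)
      rw [Subsingleton.elim j k]
      rfl
    · exact Or.inr ⟨hcard, fun p hp hp1 =>
        h.exists_isDeltaPPoint hx (fun k => one_pos.trans (hp k)) hp1⟩
  · rintro (⟨k, hk⟩ | ⟨hcard, h⟩)
    · exact (isMSummand_single k).isDeltaPoint (norm_eq_one_of_forall hx) hk
    · exact isDeltaPoint_pi_of_exists_isDeltaPPoint hx hcard h

theorem isNablaPoint_pi_iff (hx : ∀ k, ‖x k‖ = 1) :
    IsNablaPoint 𝕜 x ↔ (∀ k, IsNablaPoint 𝕜 (x k)) ∨ ∃ k, IsDaugavetPoint 𝕜 (x k) := by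
  classical
  constructor
  · intro h
    by_contra! hno
    obtain ⟨⟨k₀, hk₀⟩, hD⟩ := hno
    have hsel : ∀ k, ∃ (φ : StrongDual 𝕜 X) (β : ℝ), ‖φ‖ = 1 ∧ 0 < β ∧
        ¬ HasFarPoints (x k) (halfBall φ (1 - β)) ∧ (k = k₀ → RCLike.re (φ (x k)) ≤ 1 - β) := by
      intro k
      rcases eq_or_ne k k₀ with rfl | hk
      · obtain ⟨φ, β, hφ, hβ, hfar, hle⟩ := exists_not_hasFarPoints_of_not_isNablaPoint (hx k) hk₀
        exact ⟨φ, β, hφ, hβ, hfar, fun _ => hle⟩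
      · obtain ⟨φ, β, hφ, hβ, hfar⟩ := exists_not_hasFarPoints (hx k) (hD k)
        exact ⟨φ, β, hφ, hβ, hfar, fun h => absurd h hk⟩
    choose φ β hφ hβ hfar hle using hsel
    obtain ⟨Φ, hΦ⟩ := exists_pi_functional φ β
    refine not_hasFarPoints_pi hφ hβ hfar hΦ
      ((isNablaPoint_iff.1 h).2 _ _ ?_ (halfBall_pi_nonempty hφ hβ hΦ))
    -- The slice in coordinate `k₀` misses `x k₀`, so that coordinate alone has weighted deficit at
    -- least 1 and `x` is outside the product half ball.
    have hsum : ∑ k, (β k)⁻¹ * RCLike.re (φ k (x k)) ≤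
        ∑ k, ((β k)⁻¹ - if k = k₀ then 1 else 0) := by
      refine Finset.sum_le_sum fun k _ => ?_
      have hk := hβ k
      rcases eq_or_ne k k₀ with rfl | hne
      · rw [if_pos rfl]
        calc (β k)⁻¹ * RCLike.re (φ k (x k)) ≤ (β k)⁻¹ * (1 - β k) := by gcongr; exact hle k rfl
          _ = _ := by field_simp
      · rw [if_neg hne, sub_zero]
        exact mul_le_of_le_one_right (by positivity)
          ((re_apply_le_norm (φ k) (hx k).le).trans (hφ k).le)
    simpa [Finset.sum_sub_distrib, hΦ] using hsum
  · rintro (h | ⟨k, hk⟩)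
    · refine isNablaPoint_iff.2 ⟨norm_eq_one_of_forall hx, fun Φ c hxc hne => ?_⟩
      obtain ⟨w, hw⟩ := hne
      have hlt := hxc.trans_lt hw.2
      rw [re_apply_eq_sum_single, re_apply_eq_sum_single Φ w] at hlt
      -- In some coordinate `w` beats `x`. Raising the patching threshold to the value at `x k`
      -- excludes `x k` but keeps `w k`.
      obtain ⟨k, -, hk⟩ := Finset.exists_lt_of_sum_lt hlt
      have hS := isMSummand_single (𝕜 := 𝕜) (X := X) k
      have hwk := hS.proj_mem_halfBall hw
      have hfar := (isNablaPoint_iff.1 (h k)).2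
        (Φ.comp (ContinuousLinearMap.single 𝕜 (fun _ : ι => X) k)) _ (le_max_right _ _)
        ⟨w k, hwk.1, max_lt hwk.2 hk⟩
      exact hS.hasFarPoints_of_patch (f := x) hfar
        fun y hy => hS.patch_mem_halfBall hw.1 ⟨hy.1, (le_max_left _ _).trans_lt hy.2⟩
    · exact ((isMSummand_single k).isDaugavetPoint (norm_eq_one_of_forall hx) hk).isNablaPoint

end Pi

/-! ### Norms, restriction and extension in `C₀(L, X)` -/

namespace ZeroAtInftyContinuousMap

open Filter Topology

section Basic

variable {L X : Type*} [TopologicalSpace L] [NormedAddCommGroup X]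

theorem norm_apply_le (f : C₀(L, X)) (x : L) : ‖f x‖ ≤ ‖f‖ :=
  f.toBCF.norm_coe_le_norm x

theorem norm_le_iff {f : C₀(L, X)} {r : ℝ} (hr : 0 ≤ r) : ‖f‖ ≤ r ↔ ∀ x, ‖f x‖ ≤ r :=
  BoundedContinuousFunction.norm_le (f := f.toBCF) hr

theorem isCompact_setOf_le_norm (f : C₀(L, X)) {r : ℝ} (hr : 0 < r) :
    IsCompact {x | r ≤ ‖f x‖} := by
  have h : ∀ᶠ x in cocompact L, ‖f x‖ < r := by
    have := (zero_at_infty f).norm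
    rw [norm_zero] at this
    exact this.eventually_lt_const hr
  obtain ⟨K, hK, hsub⟩ := mem_cocompact.1 h
  refine hK.of_isClosed_subset (isClosed_le continuous_const (map_continuous f).norm) ?_
  intro x hx
  by_contra hxK
  have hlt : ‖f x‖ < r := hsub hxK
  exact hlt.not_ge hx

theorem exists_norm_apply_eq {f : C₀(L, X)} (hf : f ≠ 0) : ∃ x, ‖f x‖ = ‖f‖ := by
  have hpos : 0 < ‖f‖ := norm_pos_iff.2 hf
  have hne : {x | ‖f‖ / 2 ≤ ‖f x‖}.Nonempty := by
    by_contra! hempty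
    have : ‖f‖ ≤ ‖f‖ / 2 := (norm_le_iff (by positivity)).2 fun x => by
      by_contra! hx
      exact Set.eq_empty_iff_forall_notMem.1 hempty x hx.le
    linarith
  obtain ⟨x, hx, hmax⟩ := (f.isCompact_setOf_le_norm (half_pos hpos)).exists_isMaxOn hne
    (map_continuous f).norm.continuousOn
  refine ⟨x, le_antisymm (f.norm_apply_le x) ((norm_le_iff (norm_nonneg _)).2 fun y => ?_)⟩
  rcases le_or_gt (‖f‖ / 2) ‖f y‖ with hy | hy
  · exact hmax hy
  · exact hy.le.trans hx

/-- Off an open set containing all points where `f` attains its norm, `f` is uniformly smaller. -/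
theorem exists_forall_norm_le_sub {f : C₀(L, X)} (hf : 0 < ‖f‖) {T : Set L} (hT : IsOpen T)
    (h : ∀ x, ‖f x‖ = ‖f‖ → x ∈ T) : ∃ η > 0, ∀ x ∉ T, ‖f x‖ ≤ ‖f‖ - η := by
  have hK : IsCompact ({x | ‖f‖ / 2 ≤ ‖f x‖} ∩ Tᶜ) :=
    (f.isCompact_setOf_le_norm (half_pos hf)).inter_right hT.isClosed_compl
  rcases Set.eq_empty_or_nonempty ({x | ‖f‖ / 2 ≤ ‖f x‖} ∩ Tᶜ) with he | hne
  · refine ⟨‖f‖ / 2, half_pos hf, fun x hx => ?_⟩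
    by_contra! hlt
    exact Set.eq_empty_iff_forall_notMem.1 he x
      ⟨by simp only [Set.mem_ofPred_eq]; linarith, hx⟩
  · obtain ⟨x, hx, hmax⟩ := hK.exists_isMaxOn hne (map_continuous f).norm.continuousOn
    have hlt : ‖f x‖ < ‖f‖ := lt_of_le_of_ne (f.norm_apply_le x) fun he => hx.2 (h x he)
    have hx2 : ‖f‖ / 2 ≤ ‖f x‖ := hx.1
    refine ⟨‖f‖ - ‖f x‖, sub_pos.2 hlt, fun y hy => ?_⟩
    rw [sub_sub_cancel]
    rcases le_or_gt (‖f‖ / 2) ‖f y‖ with hy' | hy'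
    · exact hmax ⟨hy', hy⟩
    · exact hy'.le.trans hx2

variable (𝕜 : Type*) [RCLike 𝕜] [NormedSpace 𝕜 X]

/-- The pointwise product of a `[0, 1]`-valued continuous function and a function in `C₀`. -/
def bumpSMul (u : C(L, ℝ)) (hu : ∀ x, u x ∈ Set.Icc (0 : ℝ) 1) (h : C₀(L, X)) : C₀(L, X) where
  toFun x := ((u x : ℝ) : 𝕜) • h x
  continuous_toFun := (RCLike.continuous_ofReal.comp u.continuous).smul (map_continuous h)
  zero_at_infty' := by
    refine squeeze_zero_norm (a := fun x => ‖h x‖) (fun x => ?_) ?_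
    · rw [norm_smul, RCLike.norm_ofReal, abs_of_nonneg (hu x).1]
      exact mul_le_of_le_one_left (norm_nonneg _) (hu x).2
    · simpa using (zero_at_infty h).norm

@[simp]
theorem bumpSMul_apply (u : C(L, ℝ)) (hu : ∀ x, u x ∈ Set.Icc (0 : ℝ) 1) (h : C₀(L, X)) (x : L) :
    bumpSMul 𝕜 u hu h x = ((u x : ℝ) : 𝕜) • h x := rfl

/-- Evaluation at a point as a continuous linear map. -/
noncomputable def evalCLM (s : L) : C₀(L, X) →L[𝕜] X :=
  LinearMap.mkContinuous
    { toFun := fun g => g s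
      map_add' := fun _ _ => rfl
      map_smul' := fun _ _ => rfl } 1 fun g => by simpa using g.norm_apply_le s

@[simp]
theorem evalCLM_apply (s : L) (g : C₀(L, X)) : evalCLM 𝕜 s g = g s := rfl

/-- Restriction to a closed set as a continuous linear map. -/
noncomputable def restrictCLM (T : Set L) (hT : IsClosed T) : C₀(L, X) →L[𝕜] C₀(T, X) :=
  LinearMap.mkContinuous
    { toFun := fun g => restrictC0 g T hT
      map_add' := fun _ _ => rfl
      map_smul' := fun _ _ => rfl } 1 fun g => by
      rw [one_mul]
      exact (norm_le_iff (norm_nonneg _)).2 fun x => g.norm_apply_le x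

@[simp]
theorem restrictCLM_apply_apply (T : Set L) (hT : IsClosed T) (g : C₀(L, X)) (s : T) :
    restrictCLM 𝕜 T hT g s = g s := rfl

open Classical in
/-- Extension by zero from a finite set of isolated points. -/
noncomputable def extend {T : Set L} (hfin : T.Finite) (hcl : IsClosed T)
    (hiso : ∀ t ∈ T, IsOpen ({t} : Set L)) (g : C₀(T, X)) : C₀(L, X) where
  toFun x := if h : x ∈ T then g ⟨x, h⟩ else 0
  continuous_toFun := by
    refine continuous_iff_continuousAt.2 fun x => ?_
    by_cases hx : x ∈ T
    · refine continuousAt_const.congr (f := fun _ => g ⟨x, hx⟩) ?_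
      filter_upwards [(hiso x hx).mem_nhds rfl] with y hy
      obtain rfl : y = x := hy
      rw [dif_pos hx]
    · refine continuousAt_const.congr (f := fun _ => (0 : X)) ?_
      filter_upwards [hcl.isOpen_compl.mem_nhds hx] with y hy
      rw [dif_neg hy]
  zero_at_infty' := by
    refine tendsto_const_nhds.congr' (f₁ := fun _ => (0 : X)) ?_
    filter_upwards [hfin.isCompact.compl_mem_cocompact] with y hy
    rw [dif_neg hy]

theorem extend_apply_of_mem {T : Set L} (hfin : T.Finite) (hcl : IsClosed T)
    (hiso : ∀ t ∈ T, IsOpen ({t} : Set L)) (g : C₀(T, X)) {x : L} (hx : x ∈ T) :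
    extend hfin hcl hiso g x = g ⟨x, hx⟩ := dif_pos hx

theorem extend_apply_of_notMem {T : Set L} (hfin : T.Finite) (hcl : IsClosed T)
    (hiso : ∀ t ∈ T, IsOpen ({t} : Set L)) (g : C₀(T, X)) {x : L} (hx : x ∉ T) :
    extend hfin hcl hiso g x = 0 := dif_neg hx

/-- Extension by zero from a finite set of isolated points as a continuous linear map. -/
noncomputable def extendCLM {T : Set L} (hfin : T.Finite) (hcl : IsClosed T)
    (hiso : ∀ t ∈ T, IsOpen ({t} : Set L)) : C₀(T, X) →L[𝕜] C₀(L, X) :=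
  LinearMap.mkContinuous
    { toFun := extend hfin hcl hiso
      map_add' := fun g h => by
        ext x
        by_cases hx : x ∈ T
        · simp [extend_apply_of_mem, hx]
        · simp [extend_apply_of_notMem, hx]
      map_smul' := fun c g => by
        ext x
        by_cases hx : x ∈ T
        · simp [extend_apply_of_mem, hx]
        · simp [extend_apply_of_notMem, hx] } 1 fun g => by
      rw [one_mul]
      refine (norm_le_iff (norm_nonneg _)).2 fun x => ?_
      by_cases hx : x ∈ T
      · exact (congrArg norm (extend_apply_of_mem hfin hcl hiso g hx)).trans_le
          (g.norm_apply_le _)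
      · refine (congrArg norm (extend_apply_of_notMem hfin hcl hiso g hx)).trans_le ?_
        simp

theorem extendCLM_apply_of_mem {T : Set L} (hfin : T.Finite) (hcl : IsClosed T)
    (hiso : ∀ t ∈ T, IsOpen ({t} : Set L)) (g : C₀(T, X)) {x : L} (hx : x ∈ T) :
    extendCLM 𝕜 hfin hcl hiso g x = g ⟨x, hx⟩ := dif_pos hx

theorem extendCLM_apply_of_notMem {T : Set L} (hfin : T.Finite) (hcl : IsClosed T)
    (hiso : ∀ t ∈ T, IsOpen ({t} : Set L)) (g : C₀(T, X)) {x : L} (hx : x ∉ T) :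
    extendCLM 𝕜 hfin hcl hiso g x = 0 := dif_neg hx

theorem isMSummand_extendCLM {T : Set L} (hfin : T.Finite) (hcl : IsClosed T)
    (hiso : ∀ t ∈ T, IsOpen ({t} : Set L)) :
    IsMSummand (extendCLM (X := X) 𝕜 hfin hcl hiso) (restrictCLM 𝕜 T hcl) where
  left_inv g := by
    ext s
    rw [restrictCLM_apply_apply, extendCLM_apply_of_mem 𝕜 hfin hcl hiso g s.2]
  norm_proj_le w := (norm_le_iff (norm_nonneg _)).2 fun x => w.norm_apply_le x
  norm_patch_le w y hw hy := by
    refine (norm_le_iff zero_le_one).2 fun x => ?_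
    rw [add_apply]
    by_cases hx : x ∈ T
    · rw [extendCLM_apply_of_mem 𝕜 hfin hcl hiso _ hx, sub_apply, restrictCLM_apply_apply,
        add_sub_cancel]
      exact (y.norm_apply_le _).trans hy
    · rw [extendCLM_apply_of_notMem 𝕜 hfin hcl hiso _ hx, add_zero]
      exact (w.norm_apply_le x).trans hw

theorem norm_sub_le_max_restrictCLM {T : Set L} (hcl : IsClosed T) {f : C₀(L, X)} {η : ℝ}
    (hη : ∀ x ∉ T, ‖f x‖ ≤ 1 - η) {w : C₀(L, X)} (hw : ‖w‖ ≤ 1) :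
    ‖f - w‖ ≤ max ‖restrictCLM 𝕜 T hcl f - restrictCLM 𝕜 T hcl w‖ (2 - η) := by
  refine (norm_le_iff (le_max_of_le_left (norm_nonneg _))).2 fun x => ?_
  by_cases hx : x ∈ T
  · exact le_max_of_le_left
      ((restrictCLM 𝕜 T hcl f - restrictCLM 𝕜 T hcl w).norm_apply_le ⟨x, hx⟩)
  · have h1 := hη x hx
    have h2 := (w.norm_apply_le x).trans hw
    exact le_max_of_le_right ((norm_sub_le (f x) (w x)).trans (by linarith))

/-- On a finite discrete space, `C₀` is a finite `ℓ_∞`-sum. -/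
noncomputable def piIsometry {T ι : Type*} [TopologicalSpace T] [DiscreteTopology T] [Finite T]
    [Fintype ι] (σ : ι ≃ T) : C₀(T, X) ≃ₗᵢ[𝕜] (ι → X) where
  toFun g k := g (σ k)
  map_add' _ _ := rfl
  map_smul' _ _ := rfl
  invFun v := ⟨⟨fun s => v (σ.symm s), continuous_of_discreteTopology⟩, by simp⟩
  left_inv g := by ext s; simp
  right_inv v := by funext k; simp
  norm_map' g := by
    refine le_antisymm ((pi_norm_le_iff_of_nonneg (norm_nonneg _)).2 fun k => g.norm_apply_le _)
      ((norm_le_iff (norm_nonneg _)).2 fun s => ?_)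
    have := norm_le_pi_norm (fun k => g (σ k)) (σ.symm s)
    simp only [Equiv.apply_symm_apply] at this
    exact this

variable {𝕜}

/-- Unimodular coefficients make all values of `φ` nonnegative reals. At each point at most one bump
is nonzero, so the resulting combination `w` still has norm at most `‖h‖`. -/
theorem sum_norm_apply_bumpSMul_le {F : Finset L} {u : L → C(L, ℝ)}
    (hu : ∀ s x, u s x ∈ Set.Icc (0 : ℝ) 1)
    (hdisj : ∀ s ∈ F, ∀ s' ∈ F, s ≠ s' → ∀ x, u s x = 0 ∨ u s' x = 0)
    (φ : StrongDual 𝕜 C₀(L, X)) (h : C₀(L, X)) :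
    ∑ s ∈ F, ‖φ (bumpSMul 𝕜 (u s) (hu s) h)‖ ≤ ‖φ‖ * ‖h‖ := by
  choose c hc hcφ using fun s => RCLike.exists_norm_eq_mul_self (φ (bumpSMul 𝕜 (u s) (hu s) h))
  set w : C₀(L, X) := ∑ s ∈ F, c s • bumpSMul 𝕜 (u s) (hu s) h with hw
  have hwx : ∀ x, w x = ∑ s ∈ F, c s • ((u s x : ℝ) : 𝕜) • h x := fun x => by
    rw [← evalCLM_apply 𝕜 x w, hw, map_sum]
    rfl
  have hwn : ‖w‖ ≤ ‖h‖ := by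
    refine (norm_le_iff (norm_nonneg _)).2 fun x => ?_
    rw [hwx]
    by_cases hx : ∃ s ∈ F, u s x ≠ 0
    · obtain ⟨s, hs, hsx⟩ := hx
      rw [Finset.sum_eq_single_of_mem s hs fun s' hs' hne => by
        rw [(hdisj s hs s' hs' hne.symm x).resolve_left hsx]
        simp]
      rw [norm_smul, norm_smul, hc, one_mul, RCLike.norm_ofReal, abs_of_nonneg (hu s x).1]
      exact (mul_le_of_le_one_left (norm_nonneg _) (hu s x).2).trans (h.norm_apply_le x)
    · push Not at hx
      rw [Finset.sum_eq_zero fun s hs => by rw [hx s hs]; simp]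
      simp
  have hsum : ((∑ s ∈ F, ‖φ (bumpSMul 𝕜 (u s) (hu s) h)‖ : ℝ) : 𝕜) = φ w := by
    rw [RCLike.ofReal_sum, hw, map_sum]
    exact Finset.sum_congr rfl fun s _ => by rw [hcφ, map_smul, smul_eq_mul]
  calc ∑ s ∈ F, ‖φ (bumpSMul 𝕜 (u s) (hu s) h)‖
      = ‖((∑ s ∈ F, ‖φ (bumpSMul 𝕜 (u s) (hu s) h)‖ : ℝ) : 𝕜)‖ := by
        rw [RCLike.norm_ofReal, abs_of_nonneg (Finset.sum_nonneg fun _ _ => norm_nonneg _)]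
    _ ≤ ‖φ‖ * ‖w‖ := by rw [hsum]; exact φ.le_opNorm w
    _ ≤ ‖φ‖ * ‖h‖ := by gcongr

end Basic

/-! ### Bump functions and non-isolated norm-attaining points -/

section LocallyCompact

variable {L X : Type*} [TopologicalSpace L] [LocallyCompactSpace L] [T2Space L]
  [NormedAddCommGroup X]

theorem exists_apply_eq (𝕜 : Type*) [RCLike 𝕜] [NormedSpace 𝕜 X] (s : L) (y : X) : ∃ w : C₀(L, X), w s = y ∧ ‖w‖ ≤ ‖y‖ := by
  let _ : NormedSpace ℝ X := NormedSpace.restrictScalars ℝ 𝕜 X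
  obtain ⟨u, hu1, -, hucomp, hu⟩ := exists_continuous_one_zero_of_isCompact
    (isCompact_singleton (x := s)) isClosed_empty (Set.disjoint_empty _)
  refine ⟨⟨⟨fun x => u x • y, by fun_prop⟩, ?_⟩, ?_, (norm_le_iff (norm_nonneg _)).2 fun x => ?_⟩
  · have := hucomp.is_zero_at_infty
    simpa using this.smul_const y
  · change u s • y = y
    rw [hu1 rfl, Pi.one_apply, one_smul]
  · change ‖u x • y‖ ≤ ‖y‖
    rw [norm_smul, Real.norm_of_nonneg (hu x).1]
    exact mul_le_of_le_one_left (norm_nonneg _) (hu x).2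

/-- A finite set of points carries bump functions with disjoint supports. -/
theorem exists_disjoint_bumps (F : Finset L) : ∃ u : L → C(L, ℝ),
    (∀ s x, u s x ∈ Set.Icc (0 : ℝ) 1) ∧ (∀ s, u s s = 1) ∧
      ∀ s ∈ F, ∀ s' ∈ F, s ≠ s' → ∀ x, u s x = 0 ∨ u s' x = 0 := by
  obtain ⟨U, hU, hdisj⟩ := F.finite_toSet.t2_separation
  choose u hu1 hu0 _ hu using fun s => exists_continuous_one_zero_of_isCompact
    (isCompact_singleton (x := s)) (hU s).2.isClosed_compl
    (Set.disjoint_singleton_left.2 fun h => h (hU s).1)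
  refine ⟨u, hu, fun s => hu1 s rfl, fun s hs s' hs' hne x => ?_⟩
  by_cases hx : x ∈ U s
  · exact Or.inr (hu0 s' fun hx' => Set.disjoint_left.1 (hdisj hs hs' hne) hx hx')
  · exact Or.inl (hu0 s hx)

variable {𝕜 : Type*} [RCLike 𝕜] [NormedSpace 𝕜 X]

theorem isCcsDaugavetPoint_of_mem_derivedSet {f : C₀(L, X)} (hf : ‖f‖ = 1) {t₀ : L}
    (ht₀ : t₀ ∈ derivedSet (Set.univ : Set L)) (hft₀ : ‖f t₀‖ = 1) :
    IsCcsDaugavetPoint 𝕜 f := by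
  refine isCcsDaugavetPoint_iff.2 ⟨hf, fun n c φ a hc hc1 hne ε hε => ?_⟩
  choose g hg hga using hne
  have : (𝓝[≠] t₀).NeBot := by
    simpa [mem_derivedSet, AccPt] using ht₀
  have hinf : {x | 1 - ε / 2 < ‖f x‖}.Infinite := by
    refine infinite_of_mem_nhds t₀ ((isOpen_lt continuous_const (map_continuous f).norm).mem_nhds ?_)
    simp only [Set.mem_ofPred_eq, hft₀]
    linarith
  obtain ⟨δ, hδ, hδa⟩ : ∃ δ > 0, ∀ i, a i + δ ≤ RCLike.re (φ i (g i)) := by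
    rcases isEmpty_or_nonempty (Fin n) with h | h
    · exact ⟨1, one_pos, fun i => isEmptyElim i⟩
    · obtain ⟨i₀, hi₀⟩ := Finite.exists_min fun i => RCLike.re (φ i (g i)) - a i
      exact ⟨_, sub_pos.2 (hga i₀), fun i => by linarith [hi₀ i]⟩
  -- With this many bumps, a change of at least `δ` for each of them would exceed the total bound on
  -- the changes.
  obtain ⟨N, hN⟩ := exists_nat_gt ((∑ i, ‖φ i‖ * ‖g i + f‖) / δ)
  obtain ⟨F, hFsub, hFcard⟩ := hinf.exists_subset_card_eq N
  obtain ⟨u, hu, hu1, hdisj⟩ := exists_disjoint_bumps F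
  obtain ⟨s, hs, hsδ⟩ : ∃ s ∈ F, ∑ i, ‖φ i (bumpSMul 𝕜 (u s) (hu s) (g i + f))‖ < δ := by
    by_contra! hge
    have h1 := Finset.sum_le_sum hge
    rw [Finset.sum_comm, Finset.sum_const, hFcard, nsmul_eq_mul] at h1
    have h2 : ∑ i, ∑ s ∈ F, ‖φ i (bumpSMul 𝕜 (u s) (hu s) (g i + f))‖ ≤
        ∑ i, ‖φ i‖ * ‖g i + f‖ :=
      Finset.sum_le_sum fun i _ => sum_norm_apply_bumpSMul_le hu hdisj (φ i) _
    rw [div_lt_iff₀ hδ] at hN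
    linarith
  -- Pointwise this is the convex combination `(1 - u s) • g i + u s • (-f)`, which stays in the
  -- ball and equals `-f s` at `s`.
  set y : Fin n → C₀(L, X) := fun i => g i - bumpSMul 𝕜 (u s) (hu s) (g i + f) with hy
  refine ⟨_, ⟨y, fun i => ⟨(norm_le_iff zero_le_one).2 fun x => ?_, ?_⟩, rfl⟩, ?_⟩
  · have h0 := (hu s x).1
    have h1 := (hu s x).2
    have hcomb : y i x = ((1 - u s x : ℝ) : 𝕜) • g i x - ((u s x : ℝ) : 𝕜) • f x := by
      simp only [hy, sub_apply, bumpSMul_apply, add_apply, smul_add, RCLike.ofReal_sub,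
        RCLike.ofReal_one, sub_smul, one_smul]
      abel
    rw [hcomb]
    refine (norm_sub_le _ _).trans ?_
    rw [norm_smul, norm_smul, RCLike.norm_ofReal, RCLike.norm_ofReal, abs_of_nonneg h0,
      abs_of_nonneg (sub_nonneg.2 h1)]
    have hgx := ((g i).norm_apply_le x).trans (hg i)
    have hfx := (f.norm_apply_le x).trans hf.le
    nlinarith
  · have h1 := Finset.single_le_sum (f := fun i => ‖φ i (bumpSMul 𝕜 (u s) (hu s) (g i + f))‖)
      (fun i _ => norm_nonneg _) (Finset.mem_univ i)
    have h2 := RCLike.re_le_norm (φ i (bumpSMul 𝕜 (u s) (hu s) (g i + f)))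
    simp only [hy, map_sub]
    linarith [hδa i]
  · have hys : ∀ i, y i s = -f s := fun i => by
      simp [hy, hu1]
    have hval : (f - ∑ i, ((c i : ℝ) : 𝕜) • y i) s = (2 : 𝕜) • f s := by
      rw [← evalCLM_apply 𝕜 s, map_sub, map_sum]
      simp only [map_smul, evalCLM_apply, hys, ← Finset.sum_smul, ← RCLike.ofReal_sum, hc1]
      rw [RCLike.ofReal_one, one_smul, sub_neg_eq_add, two_smul]
    have h1 := (f - ∑ i, ((c i : ℝ) : 𝕜) • y i).norm_apply_le s
    rw [hval, norm_smul, RCLike.norm_two] at h1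
    have h2 : 1 - ε / 2 < ‖f s‖ := hFsub hs
    linarith

end LocallyCompact

end ZeroAtInftyContinuousMap

/-- Allows the summand `C₀(T, X)` to be replaced by the coordinate model `Fin n → X`. -/
theorem IsMSummand.comp_linearIsometryEquiv {𝕜 : Type*} [RCLike 𝕜] {Y Z E : Type*}
    [NormedAddCommGroup Y] [NormedSpace 𝕜 Y] [NormedAddCommGroup Z] [NormedSpace 𝕜 Z]
    [NormedAddCommGroup E] [NormedSpace 𝕜 E] {J : Y →L[𝕜] E} {R : E →L[𝕜] Y}
    (h : IsMSummand J R) (e : Y ≃ₗᵢ[𝕜] Z) :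
    IsMSummand (J.comp (e.symm.toContinuousLinearEquiv : Z →L[𝕜] Y))
      ((e.toContinuousLinearEquiv : Y →L[𝕜] Z).comp R) where
  left_inv y := by simp [h.left_inv]
  norm_proj_le w := by simpa using h.norm_proj_le w
  norm_patch_le w y hw hy := by
    simpa using h.norm_patch_le w (e.symm y) hw (by simpa using hy)

/-! ### The set of isolated norm-attaining points and the main theorem -/

section IsolatedNormAttaining

variable {L X : Type*} [TopologicalSpace L] [NormedAddCommGroup X] {f : C₀(L, X)}

theorem isOpen_singleton_of_notMem_derivedSet {t : L}
    (ht : t ∉ derivedSet (Set.univ : Set L)) : IsOpen ({t} : Set L) := by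
  rw [isOpen_singleton_iff_punctured_nhds]
  simpa [mem_derivedSet, AccPt, Filter.not_neBot] using ht

theorem isOpen_singleton_of_mem_isolatedNormAttaining {t : L}
    (ht : t ∈ isolatedNormAttaining f) : IsOpen ({t} : Set L) :=
  isOpen_singleton_of_notMem_derivedSet ht.1

theorem isOpen_isolatedNormAttaining : IsOpen (isolatedNormAttaining f) := by
  rw [← Set.biUnion_of_singleton (isolatedNormAttaining f)]
  exact isOpen_biUnion fun t ht => isOpen_singleton_of_mem_isolatedNormAttaining ht

theorem mem_isolatedNormAttaining_iff
    (h : ¬ ∃ t₀ ∈ derivedSet (Set.univ : Set L), ‖f t₀‖ = ‖f‖) {t : L} :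
    t ∈ isolatedNormAttaining f ↔ ‖f t‖ = ‖f‖ :=
  ⟨fun ht => ht.2, fun ht => ⟨fun hd => h ⟨t, hd, ht⟩, ht⟩⟩

/-- The set is a superlevel set of the norm of `f` at a positive level, hence compact, and it
consists of isolated points. -/
theorem finite_isolatedNormAttaining
    (h : ¬ ∃ t₀ ∈ derivedSet (Set.univ : Set L), ‖f t₀‖ = ‖f‖) (hf : f ≠ 0) :
    (isolatedNormAttaining f).Finite := by
  have hset : isolatedNormAttaining f = {x | ‖f‖ ≤ ‖f x‖} := by
    ext t
    rw [mem_isolatedNormAttaining_iff h]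
    exact ⟨fun ht => ht.ge, fun ht => le_antisymm (f.norm_apply_le t) ht⟩
  have hK : IsCompact (isolatedNormAttaining f) := by
    rw [hset]
    exact f.isCompact_setOf_le_norm (norm_pos_iff.2 hf)
  exact hK.finite (isDiscrete_iff_forall_mem_exists_isOpen.2 fun t ht =>
    ⟨{t}, isOpen_singleton_of_mem_isolatedNormAttaining ht, by simpa using ht⟩)

theorem nonempty_isolatedNormAttaining
    (h : ¬ ∃ t₀ ∈ derivedSet (Set.univ : Set L), ‖f t₀‖ = ‖f‖) (hf : f ≠ 0) :
    (isolatedNormAttaining f).Nonempty := by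
  obtain ⟨t, ht⟩ := ZeroAtInftyContinuousMap.exists_norm_apply_eq hf
  exact ⟨t, (mem_isolatedNormAttaining_iff h).2 ht⟩

end IsolatedNormAttaining

theorem mainTheorem1 {𝕜 : Type*} [RCLike 𝕜]
    {L : Type*} [TopologicalSpace L] [LocallyCompactSpace L] [T2Space L]
    {X : Type*} [NormedAddCommGroup X] [NormedSpace 𝕜 X] [CompleteSpace X]
    (f : C₀(L, X)) (hf : ‖f‖ = 1) :
    ((∃ t₀ ∈ derivedSet (Set.univ : Set L), ‖f t₀‖ = ‖f‖) → IsCcsDaugavetPoint 𝕜 f) ∧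
    ((¬ ∃ t₀ ∈ derivedSet (Set.univ : Set L), ‖f t₀‖ = ‖f‖) →
      ∃ hT : (isolatedNormAttaining f).Finite, (isolatedNormAttaining f).Nonempty ∧
        ∀ (n : ℕ) (t : Fin n → L), Function.Injective t →
          Set.range t = isolatedNormAttaining f →
          -- `C₀(T, X)` is the `ℓ_∞`-sum of `n` copies of `X`
          (∃ e : C₀(isolatedNormAttaining f, X) ≃ₗᵢ[𝕜] (Fin n → X),
            ∀ (g : C₀(isolatedNormAttaining f, X)) (k : Fin n) (s : isolatedNormAttaining f),
              (s : L) = t k → e g k = g s) ∧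
          -- (a)
          (IsSuperDaugavetPoint 𝕜 f ↔
            IsSuperDaugavetPoint 𝕜 (restrictC0 f (isolatedNormAttaining f) hT.isClosed)) ∧
          (IsSuperDeltaPoint 𝕜 f ↔
            IsSuperDeltaPoint 𝕜 (restrictC0 f (isolatedNormAttaining f) hT.isClosed)) ∧
          (IsCcsDaugavetPoint 𝕜 f ↔
            IsCcsDaugavetPoint 𝕜 (restrictC0 f (isolatedNormAttaining f) hT.isClosed)) ∧
          -- (b)
          (IsDaugavetPoint 𝕜 f ↔ ∃ k, IsDaugavetPoint 𝕜 (f (t k))) ∧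
          -- (c)
          (IsCcsDeltaPoint 𝕜 f →
            IsCcsDeltaPoint 𝕜 (restrictC0 f (isolatedNormAttaining f) hT.isClosed)) ∧
          -- (d)
          (IsDeltaPoint 𝕜 f ↔
            (∃ k, IsDeltaPoint 𝕜 (f (t k))) ∨
            (2 ≤ n ∧ ∀ p : Fin n → ℝ, (∀ k, 1 < p k) → ∑ k, 1 / p k = 1 →
              ∃ k, IsDeltaPPoint 𝕜 (p k) (f (t k)))) ∧
          -- (e); `RCLike.I ≠ 0` says that the scalar field is complex
          ((isolatedNormAttaining f ≠ Set.univ ∨ (RCLike.I : 𝕜) ≠ 0) →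
            (IsNablaPoint 𝕜 f ↔ IsDaugavetPoint 𝕜 f)) ∧
          -- (f)
          (isolatedNormAttaining f = Set.univ →
            (IsNablaPoint 𝕜 f ↔
              (∀ k, IsNablaPoint 𝕜 (f (t k))) ∨ ∃ k, IsDaugavetPoint 𝕜 (f (t k))) ∧
            ((∃ k, IsDaugavetPoint 𝕜 (f (t k))) → IsDaugavetPoint 𝕜 f))) := by
  have hf0 : f ≠ 0 := norm_ne_zero_iff.1 (by simp [hf])
  refine ⟨fun ⟨t₀, ht₀, hft₀⟩ =>
    ZeroAtInftyContinuousMap.isCcsDaugavetPoint_of_mem_derivedSet hf ht₀ (hft₀.trans hf),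
    fun h => ?_⟩
  refine ⟨finite_isolatedNormAttaining h hf0, nonempty_isolatedNormAttaining h hf0,
    fun n t ht hrange => ?_⟩
  have hT := finite_isolatedNormAttaining h hf0
  have hmem : ∀ k, t k ∈ isolatedNormAttaining f := fun k => hrange ▸ Set.mem_range_self k
  obtain ⟨k₀⟩ : Nonempty (Fin n) := by
    rw [← Set.range_nonempty_iff_nonempty (f := t), hrange]
    exact nonempty_isolatedNormAttaining h hf0
  have : Nonempty (Fin n) := ⟨k₀⟩
  have : Finite (isolatedNormAttaining f) := hT.to_subtype
  obtain ⟨η, hη, hoff⟩ := ZeroAtInftyContinuousMap.exists_forall_norm_le_sub (f := f)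
    (by simp [hf]) isOpen_isolatedNormAttaining fun x => (mem_isolatedNormAttaining_iff h).2
  rw [hf] at hoff
  let σ : Fin n ≃ isolatedNormAttaining f := Equiv.ofBijective (fun k => ⟨t k, hmem k⟩)
    ⟨fun i j hij => ht (congrArg Subtype.val hij), fun ⟨s, hs⟩ => by
      rw [← hrange] at hs
      obtain ⟨k, rfl⟩ := hs
      exact ⟨k, rfl⟩⟩
  let e : C₀(isolatedNormAttaining f, X) ≃ₗᵢ[𝕜] (Fin n → X) :=
    ZeroAtInftyContinuousMap.piIsometry 𝕜 σ
  let R := ZeroAtInftyContinuousMap.restrictCLM (X := X) 𝕜 _ hT.isClosed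
  let J := ZeroAtInftyContinuousMap.extendCLM (X := X) 𝕜 hT hT.isClosed
    fun s hs => isOpen_singleton_of_mem_isolatedNormAttaining hs
  have hJR : IsMSummand J R := ZeroAtInftyContinuousMap.isMSummand_extendCLM 𝕜 hT hT.isClosed _
  have hfar : ∀ w, ‖w‖ ≤ 1 → ‖f - w‖ ≤ max ‖R f - R w‖ (2 - η) := fun w hw =>
    ZeroAtInftyContinuousMap.norm_sub_le_max_restrictCLM 𝕜 hT.isClosed hoff hw
  have hfk : ∀ k, ‖f (t k)‖ = 1 := fun k => (hmem k).2.trans hf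
  have hRf : ‖R f‖ = 1 := le_antisymm ((hJR.norm_proj_le f).trans hf.le)
    ((hfk k₀).symm.le.trans ((R f).norm_apply_le ⟨t k₀, hmem k₀⟩))
  have hJR' := hJR.comp_linearIsometryEquiv e
  have hR'f : ((e.toContinuousLinearEquiv : _ →L[𝕜] (Fin n → X)).comp R) f = fun k => f (t k) := rfl
  have hfar' : ∀ w, ‖w‖ ≤ 1 → ‖f - w‖ ≤
      max ‖((e.toContinuousLinearEquiv : _ →L[𝕜] (Fin n → X)).comp R) f -
        ((e.toContinuousLinearEquiv : _ →L[𝕜] (Fin n → X)).comp R) w‖ (2 - η) := fun w hw => by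
    change ‖f - w‖ ≤ max ‖e (R f) - e (R w)‖ (2 - η)
    rw [← map_sub e, e.norm_map]
    exact hfar w hw
  have hpi : ‖fun k => f (t k)‖ = 1 := norm_eq_one_of_forall hfk
  have hD : IsDaugavetPoint 𝕜 f ↔ ∃ k, IsDaugavetPoint 𝕜 (f (t k)) := by
    rw [← isDaugavetPoint_pi_iff (x := fun k => f (t k)) hfk, ← hR'f]
    exact ⟨hJR'.isDaugavetPoint_proj hpi hη hfar', hJR'.isDaugavetPoint hf⟩
  refine ⟨⟨e, fun g k s hs => congrArg g (Subtype.ext hs.symm)⟩,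
    ⟨hJR.isSuperDaugavetPoint_proj hRf hη hfar, hJR.isSuperDaugavetPoint hf⟩,
    ⟨hJR.isSuperDeltaPoint_proj hRf hη hfar, hJR.isSuperDeltaPoint hf⟩,
    ⟨hJR.isCcsDaugavetPoint_proj hRf hη hfar, hJR.isCcsDaugavetPoint hf⟩, hD,
    hJR.isCcsDeltaPoint_proj hRf hη hfar, ?_, fun hLI => ⟨fun hN => ?_, fun hN => hN.isNablaPoint⟩,
    fun huniv => ⟨?_, hD.2⟩⟩
  · have := isDeltaPoint_pi_iff (𝕜 := 𝕜) (x := fun k => f (t k)) hfk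
    rw [Fintype.card_fin] at this
    rw [← this, ← hR'f]
    exact ⟨hJR'.isDeltaPoint_proj hpi hη hfar', hJR'.isDeltaPoint hf⟩
  · rcases hLI with hL | hI
    · obtain ⟨s, hs⟩ := (Set.ne_univ_iff_exists_notMem _).1 hL
      -- The auxiliary functional is `χ` composed with evaluation at `s ∉ T`. It kills extensions
      -- from `T`, has norm 1 as `w` shows, and is at most `1 - η` at `f`.
      obtain ⟨χ, hχ, hχf⟩ := exists_dual_vector 𝕜 (f (t k₀)) (by rw [hfk]; exact one_ne_zero)
      obtain ⟨w, hws, hw⟩ := ZeroAtInftyContinuousMap.exists_apply_eq 𝕜 s (f (t k₀))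
      rw [hfk] at hχf hw
      refine hJR.isDaugavetPoint hf (hJR.isDaugavetPoint_proj_of_isNablaPoint hRf hη hfar
        (ψ := χ.comp (ZeroAtInftyContinuousMap.evalCLM 𝕜 s)) (fun y => ?_) (le_antisymm ?_ ?_) ?_ hN)
      · rw [ContinuousLinearMap.comp_apply, ZeroAtInftyContinuousMap.evalCLM_apply,
          ZeroAtInftyContinuousMap.extendCLM_apply_of_notMem 𝕜 _ _ _ _ hs, map_zero]
      · refine ContinuousLinearMap.opNorm_le_bound _ zero_le_one fun g => ?_
        have := χ.le_of_opNorm_le hχ.le (g s)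
        exact this.trans (by gcongr; exact g.norm_apply_le s)
      · have := re_apply_le_norm (χ.comp (ZeroAtInftyContinuousMap.evalCLM 𝕜 s)) hw
        rwa [ContinuousLinearMap.comp_apply, ZeroAtInftyContinuousMap.evalCLM_apply, hws, hχf,
          RCLike.ofReal_one, RCLike.one_re] at this
      · refine (RCLike.re_le_norm _).trans ((χ.le_of_opNorm_le hχ.le (f s)).trans ?_)
        rw [one_mul]
        exact hoff s hs
    · exact hN.isDaugavetPoint_of_I_ne_zero hI
  · rw [← isNablaPoint_pi_iff (x := fun k => f (t k)) hfk, ← hR'f]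
    -- Since `T` is all of `L`, extending the restriction recovers the function.
    refine ⟨hJR'.isNablaPoint_proj hpi hη hfar', hJR'.isNablaPoint (fun w => ?_) hf⟩
    simp only [ContinuousLinearMap.comp_apply, ContinuousLinearEquiv.coe_coe,
      LinearIsometryEquiv.coe_toContinuousLinearEquiv, LinearIsometryEquiv.symm_apply_apply]
    ext x
    exact ZeroAtInftyContinuousMap.extendCLM_apply_of_mem 𝕜 _ _ _ _ (huniv ▸ Set.mem_univ x)
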